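/- Let $n\in\mathbb N$ and let $\mathbb H^n=\mathbb R^n\times\mathbb R^n\times\mathbb R$ be the Heisenberg group with group law $(x,y,t)(u,v,s)=\bigl(x+u,\,y+v,\,t+s+\tfrac12(u\cdot y-v\cdot x)\bigr)$ and Haar measure $dx\,dy\,dt$. For $p\in\mathbb H^n$ put $L_pf(X)=f(p^{-1}X)$. A family $(f_i)$ is a frame for a closed subspace $V_0$ of $L^2(\mathbb H^n)$ if $f_i\in V_0$ for all $i$ and there are $a,b>0$ with $a\|f\|^2\le\sum_i|\langle f,f_i\rangle|^2\le b\|f\|^2$ for all $f\in V_0$. For $\lambda\in\mathbb R^*=\mathbb R\setminus\{0\}$ let $\pi_\lambda$ be the representation of $\mathbb H^n$ on $L^2(\mathbb R^n)$ given by $\pi_\lambda(x,y,t)g(\xi)=e^{2\pi i\lambda t}e^{2\pi i\lambda(x\cdot\xi+\frac12x\cdot y)}g(\xi+y)$, and let $\widehat f(\lambda)=\int_{\mathbb H^n}f(X)\pi_\lambda(X)\,dX$ be the group Fourier transform, extended by density from $L^1\cap L^2(\mathbb H^n)$ to a map from $L^2(\mathbb H^n)$ to $L^2(\mathbb R^*,\mathcal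 B_2;|\lambda|^n d\lambda)$, where $\mathcal B_2$ is the space of Hilbert–Schmidt operators on $L^2(\mathbb R^n)$. For $\varphi\in L^2(\mathbb H^n)$ and $k,l\in\mathbb Z^n$ let $$G^\varphi_{k,l}(\lambda)=\sum_{r\in\mathbb Z}\bigl\langle\widehat\varphi(\lambda+r),\widehat{L_{(2k,l,0)}\varphi}(\lambda+r)\bigr\rangle_{\mathcal B_2}|\lambda+r|^n ,\qquad \Omega_\varphi=\{\lambda\in\mathbb R: G^\varphi_{0,0}(\lambda)>0\}.$$ We say that $\varphi$ satisfies Condition C if $G^\varphi_{k,l}(\lambda)=0$ for a.e. $\lambda\in(0,1]$, for every $(k,l)\in\mathbb Z^{2n}\setminus\{(0,0)\}$. **Theorem.** Let $V_0$ be a closed subspace of $L^2(\mathbb H^n)$. Let the function $\varphi:\mathbb H^n\to\mathbb C$ be square integrable and satisfy Condition C, and let $\{L_{(2k,l,m)}\varphi:(k,l,m)\in\mathbb Z^n\times\mathbb Z^n\times\mathbb Z\}$ be a frame for $V_0$. Suppose that for all $(k,l)\in\mathbb Z^{2n}$ and all $\{c_m\}\in\ell^2(\mathbb Z)$ the series $\sum_{m\in\mathbb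 Z}c_mL_{(2k,l,m)}\varphi$ (with symmetric partial sums) converges at every point of $\mathbb H^n$, to a continuous function. Suppose further that there is $\psi\in L^2(\mathbb H^n)$ satisfying Condition C such that $\{L_{(2k,l,m)}\psi:(k,l,m)\in\mathbb Z^n\times\mathbb Z^n\times\mathbb Z\}$ is a frame for $V_0$ and $$f=\sum_{(k,l,m)\in\mathbb Z^{2n+1}}f(2k,l,m)\,L_{(2k,l,m)}\psi$$ with (unconditional) convergence in $L^2(\mathbb H^n)$, for every $f\in V_0$ that has a continuous representative, the sample values $f(2k,l,m)$ being those of this representative. Then $\varphi$ is continuous; $$\sup_{(x,y,t)\in[0,1]^{2n+1}}\ \sum_{m\in\mathbb Z}|L_{(2k,l,m)}\varphi(x,y,t)|^2<\infty\qquad\text{for each }(k,l)\in\mathbb Z^{2n};$$ $\{\varphi(2k,l,m)\}_{m\in\mathbb Z}\in\ell^2(\mathbb Z)$ for each $(k,l)\in\mathbb Z^{2n}$, so that $P_{k,l}(\lambda)=\sum_{m\in\mathbb Z}\varphi(2k,l,m)e^{2\pi im\lambda}$ converges in $L^2(0,1)$ and defines a $1$-periodic function; and there are constants $A,B>0$ such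 that $$A\,\chi_{\Omega_\varphi}(\lambda)\ \le\ \sum_{(k,l)\in\mathbb Z^{2n}}|P_{k,l}(\lambda)|^2\ \le\ B\,\chi_{\Omega_\varphi}(\lambda)\qquad\text{for a.e. }\lambda\in\mathbb R.$$ -/

import Mathlib

open MeasureTheory Filter Topology
open scoped ENNReal

noncomputable section

namespace HeisenbergSampling

/-! ### The Heisenberg group, its lattice and left translations -/

/-- The underlying manifold `ℝⁿ × ℝⁿ × ℝ` of the Heisenberg group; its Haar measure is `volume`,
the Lebesgue measure `dx dy dt`. -/
abbrev Heis (n : ℕ) : Type :=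
  EuclideanSpace ℝ (Fin n) × EuclideanSpace ℝ (Fin n) × ℝ

/-- The group law `(x,y,t)(u,v,s) = (x+u, y+v, t+s+½(u·y - v·x))`. -/
def hmul {n : ℕ} (p q : Heis n) : Heis n :=
  (p.1 + q.1, p.2.1 + q.2.1,
    p.2.2 + q.2.2 + (1 / 2 : ℝ) * (inner ℝ q.1 p.2.1 - inner ℝ q.2.1 p.1))

/-- The inverse in the Heisenberg group. -/
def hinv {n : ℕ} (p : Heis n) : Heis n := (-p.1, -p.2.1, -p.2.2)

theorem hmul_assoc {n : ℕ} (p q r : Heis n) : hmul (hmul p q) r = hmul p (hmul q r) := by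
  refine Prod.ext ?_ (Prod.ext ?_ ?_)
  · simp [hmul, add_assoc]
  · simp [hmul, add_assoc]
  · simp only [hmul, inner_add_left, inner_add_right]
    ring

theorem hinv_hmul {n : ℕ} (p : Heis n) : hmul (hinv p) p = 0 := by
  refine Prod.ext ?_ (Prod.ext ?_ ?_)
  · simp [hmul, hinv]
  · simp [hmul, hinv]
  · simp only [hmul, hinv, inner_neg_right, real_inner_comm p.1 p.2.1]
    simp

/-- Left translation: `(L_p f)(X) = f (p⁻¹ X)`. -/
def leftTranslate {n : ℕ} (p : Heis n) (f : Heis n → ℂ) : Heis n → ℂ :=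
  fun X => f (hmul (hinv p) X)

theorem leftTranslate_apply {n : ℕ} (a b : EuclideanSpace ℝ (Fin n)) (c : ℝ) (f : Heis n → ℂ)
    (x y : EuclideanSpace ℝ (Fin n)) (t : ℝ) :
    leftTranslate (a, b, c) f (x, y, t) =
      f (x - a, y - b, t - c + (1 / 2 : ℝ) * (inner ℝ y a - inner ℝ x b)) := by
  unfold leftTranslate
  congr 1
  refine Prod.ext ?_ (Prod.ext ?_ ?_)
  · simp [hmul, hinv, sub_eq_neg_add]
  · simp [hmul, hinv, sub_eq_neg_add]
  · simp only [hmul, hinv, inner_neg_right]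
    ring

theorem measurePreserving_hmul {n : ℕ} (p : Heis n) :
    MeasurePreserving (hmul p) (volume : Measure (Heis n)) volume := by
  have hin : ∀ x : EuclideanSpace ℝ (Fin n),
      MeasurePreserving (fun q : EuclideanSpace ℝ (Fin n) × ℝ =>
        (p.2.1 + q.1, p.2.2 + q.2 + (1 / 2 : ℝ) * (inner ℝ x p.2.1 - inner ℝ q.1 p.1)))
        volume volume := by
    intro x
    refine MeasurePreserving.skew_product (f := fun y => p.2.1 + y)
      (g := fun y t => p.2.2 + t + (1 / 2 : ℝ) * (inner ℝ x p.2.1 - inner ℝ y p.1))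
      (measurePreserving_add_left volume p.2.1) ?_ ?_
    · unfold Function.uncurry
      fun_prop
    · refine ae_of_all _ fun y => ?_
      have h := (measurePreserving_add_right (volume : Measure ℝ)
        (p.2.2 + (1 / 2 : ℝ) * (inner ℝ x p.2.1 - inner ℝ y p.1))).map_eq
      have e : (fun t : ℝ => p.2.2 + t + (1 / 2 : ℝ) * (inner ℝ x p.2.1 - inner ℝ y p.1)) =
          fun t => t + (p.2.2 + (1 / 2 : ℝ) * (inner ℝ x p.2.1 - inner ℝ y p.1)) := by
        funext t
        ring
      rw [e]
      exact h
  refine MeasurePreserving.skew_product (f := fun x => p.1 + x)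
    (g := fun x (q : EuclideanSpace ℝ (Fin n) × ℝ) =>
      (p.2.1 + q.1, p.2.2 + q.2 + (1 / 2 : ℝ) * (inner ℝ x p.2.1 - inner ℝ q.1 p.1)))
    (measurePreserving_add_left volume p.1) ?_ (ae_of_all _ fun x => (hin x).map_eq)
  unfold Function.uncurry
  fun_prop

theorem memLp_leftTranslate {n : ℕ} (p : Heis n) {f : Heis n → ℂ} (hf : MemLp f 2 volume) :
    MemLp (leftTranslate p f) 2 volume :=
  hf.comp_measurePreserving (measurePreserving_hmul (hinv p))

/-- The left translate `L_p f` as an element of `L²(ℍⁿ)`. -/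
def translateLp {n : ℕ} (p : Heis n) (f : Heis n → ℂ) (hf : MemLp f 2 volume) :
    Lp ℂ 2 (volume : Measure (Heis n)) :=
  (memLp_leftTranslate p hf).toLp (leftTranslate p f)

/-- The lattice point `(2k, l, m)`. -/
def latticePt {n : ℕ} (k l : Fin n → ℤ) (m : ℤ) : Heis n :=
  (WithLp.toLp 2 fun i => 2 * (k i : ℝ), WithLp.toLp 2 fun i => (l i : ℝ), (m : ℝ))

/-- The family `(u i)` is a frame for the subspace `V`: its members lie in `V`, and the frame
inequalities `A ‖f‖² ≤ ∑ |⟨f, u i⟩|² ≤ B ‖f‖²` hold on `V` for some `A, B > 0`. -/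
def IsFrameFor {H ι : Type*} [NormedAddCommGroup H] [InnerProductSpace ℂ H]
    (V : Submodule ℂ H) (u : ι → H) : Prop :=
  (∀ i, u i ∈ V) ∧ ∃ A B : ℝ, 0 < A ∧ 0 < B ∧ ∀ f ∈ V,
    ENNReal.ofReal (A * ‖f‖ ^ 2) ≤ (∑' i, ‖inner ℂ (u i) f‖ₑ ^ 2) ∧
    (∑' i, ‖inner ℂ (u i) f‖ₑ ^ 2) ≤ ENNReal.ofReal (B * ‖f‖ ^ 2)

/-! ### Schrödinger representations and the group Fourier transform -/

/-- The Hilbert space `L²(ℝⁿ)`. -/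
abbrev L2R (n : ℕ) : Type := Lp ℂ 2 (volume : Measure (EuclideanSpace ℝ (Fin n)))

/-- `ξ ↦ e^{2πiλt} e^{2πiλ(x·ξ + ½ x·y)} g(ξ+y)` for `p = (x,y,t)`. -/
def schrodingerFun {n : ℕ} (lam : ℝ) (p : Heis n) (g : EuclideanSpace ℝ (Fin n) → ℂ) :
    EuclideanSpace ℝ (Fin n) → ℂ :=
  fun ξ => Complex.exp (2 * Real.pi * Complex.I * lam * p.2.2) *
    Complex.exp (2 * Real.pi * Complex.I * lam *
      (inner ℝ p.1 ξ + (1 / 2 : ℝ) * inner ℝ p.1 p.2.1 : ℝ)) * g (ξ + p.2.1)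

theorem memLp_schrodingerFun {n : ℕ} (lam : ℝ) (p : Heis n) (g : L2R n) :
    MemLp (schrodingerFun lam p g) 2 volume := by
  have h : MemLp (fun ξ => g (ξ + p.2.1)) 2 volume :=
    (Lp.memLp g).comp_measurePreserving (measurePreserving_add_right volume p.2.1)
  refine h.of_le ?_ (ae_of_all _ fun ξ => ?_)
  · refine AEStronglyMeasurable.mul ?_ h.1
    exact Continuous.aestronglyMeasurable (by fun_prop)
  · have e : ∀ a b : ℝ, ‖Complex.exp (2 * Real.pi * Complex.I * a * b)‖ = 1 := by
      intro a b
      have : (2 * Real.pi * Complex.I * a * b : ℂ) = ((2 * Real.pi * a * b : ℝ) : ℂ) * Complex.I := by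
        push_cast
        ring
      rw [this, Complex.norm_exp_ofReal_mul_I]
    simp only [schrodingerFun, norm_mul, e, one_mul, le_refl]

/-- The Schrödinger representation `π_λ(p)` acting on `L²(ℝⁿ)`. -/
def schrodinger {n : ℕ} (lam : ℝ) (p : Heis n) (g : L2R n) : L2R n :=
  (memLp_schrodingerFun lam p g).toLp (schrodingerFun lam p g)

/-- The operator `f̂(λ) g = ∫ f(X) π_λ(X) g dX` on `L²(ℝⁿ)` (Bochner integral), for
`f ∈ L¹(ℍⁿ)`. -/
def fourierL1 {n : ℕ} (f : Heis n → ℂ) (lam : ℝ) : L2R n → L2R n :=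
  fun g => ∫ X : Heis n, f X • schrodinger lam X g

/-- Index set of a Hilbert basis of `L²(ℝⁿ)`. -/
def basisIndex (n : ℕ) : Set (L2R n) := (exists_hilbertBasis ℂ (L2R n)).choose

/-- A Hilbert basis of `L²(ℝⁿ)`, used to compute Hilbert-Schmidt norms and inner products (which
do not depend on it). -/
def basisL2 (n : ℕ) : HilbertBasis (basisIndex n) ℂ (L2R n) :=
  (exists_hilbertBasis ℂ (L2R n)).choose_spec.choose

/-- The squared Hilbert-Schmidt norm `∑ᵢ ‖T eᵢ‖²` of an operator, in `[0, ∞]`. -/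
def hsNormSq {n : ℕ} (T : L2R n → L2R n) : ℝ≥0∞ := ∑' i, ‖T (basisL2 n i)‖ₑ ^ 2

/-- The Hilbert-Schmidt inner product `⟨S, T⟩ = tr(T* S) = ∑ᵢ ⟨S eᵢ, T eᵢ⟩`, linear in `S`
(Mathlib's `inner` is linear in the second argument). -/
def hsInner {n : ℕ} (S T : L2R n → L2R n) : ℂ := ∑' i, inner ℂ (T (basisL2 n i)) (S (basisL2 n i))

/-- The operator-valued function `F` represents the group Fourier transform of `f ∈ L²(ℍⁿ)`:
`F` is a (strongly measurable) element of `L²(ℝ*, 𝓑₂; |λ|ⁿ dλ)`, and it is the limit in that space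
of the transforms of some functions in `L¹ ∩ L²` that converge to `f` in `L²`. -/
def IsFourierL2 {n : ℕ} (f : Heis n → ℂ) (F : ℝ → L2R n →L[ℂ] L2R n) : Prop :=
  (∀ g : L2R n, AEStronglyMeasurable (fun lam => F lam g) volume) ∧
  (∫⁻ lam : ℝ, hsNormSq (F lam) * ENNReal.ofReal (|lam| ^ n)) < ∞ ∧
  ∃ u : ℕ → Heis n → ℂ,
    (∀ j, Integrable (u j) volume ∧ MemLp (u j) 2 volume) ∧
    Tendsto (fun j => eLpNorm (u j - f) 2 volume) atTop (𝓝 0) ∧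
    Tendsto (fun j => ∫⁻ lam : ℝ,
      hsNormSq (fun g => fourierL1 (u j) lam g - F lam g) * ENNReal.ofReal (|lam| ^ n))
      atTop (𝓝 0)

open Classical in
/-- The group Fourier transform of `f ∈ L²(ℍⁿ)`, determined for almost every `λ`. -/
def fourierL2 {n : ℕ} (f : Heis n → ℂ) : ℝ → L2R n →L[ℂ] L2R n :=
  if h : ∃ F, IsFourierL2 f F then h.choose else 0

/-! ### The weight function, Condition C and the sampled Fourier series -/

/-- `G^φ_{k,l}(λ) = ∑_r ⟨φ̂(λ+r), (L_{(2k,l,0)}φ)^(λ+r)⟩_{𝓑₂} |λ+r|ⁿ`, for all real `λ`. -/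
def G {n : ℕ} (φ : Heis n → ℂ) (k l : Fin n → ℤ) (lam : ℝ) : ℂ :=
  ∑' r : ℤ, hsInner (fourierL2 φ (lam + r))
    (fourierL2 (leftTranslate (latticePt k l 0) φ) (lam + r)) * ((|lam + r| ^ n : ℝ) : ℂ)

/-- Condition C: `G^φ_{k,l} = 0` a.e. on `(0,1]` for all `(k,l) ≠ (0,0)`. -/
def ConditionC {n : ℕ} (φ : Heis n → ℂ) : Prop :=
  ∀ k l : Fin n → ℤ, (k, l) ≠ (0, 0) →
    ∀ᵐ lam ∂(volume.restrict (Set.Ioc (0 : ℝ) 1)), G φ k l lam = 0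

/-- `Ω_φ = {λ ∈ ℝ : G^φ_{0,0}(λ) > 0}`. -/
def Omega {n : ℕ} (φ : Heis n → ℂ) : Set ℝ := {lam | 0 < (G φ 0 0 lam).re}

open Classical in
/-- For `c ∈ ℓ²(ℤ)`, the 1-periodic function `λ ↦ ∑_m c_m e^{2πimλ}`, the series converging in `L²`
of a period (set to `0` if `c ∉ ℓ²(ℤ)`). -/
def fourierSeriesL2 (c : ℤ → ℂ) : ℝ → ℂ :=
  if hc : Memℓp c 2 then fun lam =>
    ((fourierBasis (T := (1 : ℝ))).repr.symm ⟨c, hc⟩ : Lp ℂ 2 (AddCircle.haarAddCircle (T := (1 : ℝ))))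
      (lam : AddCircle (1 : ℝ))
  else 0

/-- `P_{k,l}(λ) = ∑_m φ(2k,l,m) e^{2πimλ}`. -/
def P {n : ℕ} (φ : Heis n → ℂ) (k l : Fin n → ℤ) : ℝ → ℂ :=
  fourierSeriesL2 fun m => φ (latticePt k l m)

/-- The closed unit cube `[0,1]^{2n+1}`, the range of `(x,y,t) ∈ 𝕋^{2n+1}`. -/
def unitCube (n : ℕ) : Set (Heis n) :=
  {X | (∀ i, X.1 i ∈ Set.Icc (0 : ℝ) 1) ∧ (∀ i, X.2.1 i ∈ Set.Icc (0 : ℝ) 1) ∧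
    X.2.2 ∈ Set.Icc (0 : ℝ) 1}

end HeisenbergSampling

end

open scoped FourierTransform SchwartzMap ComplexConjugate

noncomputable section

namespace HeisenbergSampling

/-! ### Plancherel's theorem for integrable square integrable functions -/

section Plancherel

variable {V : Type*} [NormedAddCommGroup V] [InnerProductSpace ℝ V] [FiniteDimensional ℝ V]
  [MeasurableSpace V] [BorelSpace V]

/-! The operator `π_λ(0,0,m)` is the scalar `e^{2πimλ}`. By Plancherel's theorem on the Heisenberg
group, the inner products of `φ` with its central translates are therefore the Fourier coefficients
of a density `W` on the circle, the periodization of `‖φ̂(λ)‖²|λ|ⁿ`, which is `G^φ_{0,0}` almost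
everywhere (`exists_spectralDensity`). Hence, for each `(k,l)`, the closed span of the
`L_{(2k,l,m)}φ` is a copy of `L²(W dλ)` in which `L_{(2k,l,m)}φ` becomes the character `e^{2πimλ}`.
Condition C makes the copies for different `(k,l)` orthogonal. Testing the frame inequalities on
indicator functions then gives `A₁ ≤ W ≤ B₁` a.e. where `W ≠ 0` (`IsSpectralDensity.frame_bounds`),
and likewise `A₂ ≤ W' ≤ B₂` a.e. on the support of the density `W'` of `ψ`.

The pointwise convergence hypothesis gives continuity of `φ` by taking a single nonzero coefficient.
The uniform bound on the cube and the square summability of the samples come from Banach–Steinhaus,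
applied to the functionals `c ↦ ∑ c_m L_{(2k,l,m)}φ(X)` on `ℓ²(ℤ)` (`exists_tsum_enorm_sq_le`).

The sampling formula for `L_{(0,0,j)}φ` has the coefficients `φ(2k,l,m-j)`, so in the models for `ψ`
this function has the components `e^{2πijλ} P_{k,l}`. Comparing Fourier coefficients of inner
products yields `W = W' ∑ |P_{k,l}|²` a.e. (`IsSpectralDensity.eq_mul_tsum`). Where `W ≠ 0`, also
`W' ≠ 0`, and the sum `W / W'` lies in `[A₁/B₂, B₁/A₂]`.

Where `W` and `W'` both vanish the identity says nothing, so a second argument is needed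
(`IsSpectralDensity.ae_eq_zero`). If `c` is the coefficient sequence of the indicator of `{W = 0}`,
then `∑ c_m L_{(0,0,m)}φ` is `0` in `L²`; its pointwise sum is continuous, hence `0` everywhere, and
its lattice values are the Fourier coefficients of `P_{k,l}` restricted to `{W = 0}`. -/

theorem fourier_toLp_ae_eq {f : V → ℂ} (h1 : Integrable f) (h2 : MemLp f 2 volume) :
    (𝓕 (h2.toLp f) : Lp ℂ 2 (volume : Measure V)) =ᵐ[volume] 𝓕 f := by
  have hcont : Continuous (𝓕 f) :=
    VectorFourier.fourierIntegral_continuous Real.continuous_fourierChar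
      (innerSL ℝ).continuous₂ h1
  -- Both transforms are tested against smooth compactly supported functions. The `L²` one is moved
  -- onto the test function through tempered distributions, the integral one by Fubini.
  refine ae_eq_of_integral_contDiff_smul_eq
    ((Lp.memLp _).locallyIntegrable (by norm_num)) hcont.locallyIntegrable fun g hg hgc => ?_
  have hgC : ContDiff ℝ (⊤ : ℕ∞) (fun x => (g x : ℂ)) := Complex.ofRealCLM.contDiff.comp hg
  have hgs : HasCompactSupport (fun x => (g x : ℂ)) := hgc.comp_left (g := Complex.ofReal) rfl
  let G : 𝓢(V, ℂ) := hgs.toSchwartzMap hgC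
  have hG : ∀ x, G x = (g x : ℂ) := fun x => rfl
  have e1 : (((𝓕 (h2.toLp f) : Lp ℂ 2 (volume : Measure V)) : 𝓢'(V, ℂ))) G =
      ((h2.toLp f : Lp ℂ 2 (volume : Measure V)) : 𝓢'(V, ℂ)) (𝓕 G) := by
    rw [← Lp.fourier_toTemperedDistribution_eq, TemperedDistribution.fourier_apply]
  rw [Lp.toTemperedDistribution_apply, Lp.toTemperedDistribution_apply] at e1
  have e2 : ∫ x, (𝓕 G : 𝓢(V, ℂ)) x • (h2.toLp f) x = ∫ x, (𝓕 G : 𝓢(V, ℂ)) x • f x := by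
    refine integral_congr_ae ?_
    filter_upwards [h2.coeFn_toLp] with x hx
    rw [hx]
  have e3 : ∫ x, (𝓕 (G : V → ℂ)) x • f x = ∫ x, G x • 𝓕 f x :=
    VectorFourier.integral_fourierIntegral_smul_eq_flip (L := innerₗ V)
      Real.continuous_fourierChar continuous_inner G.integrable h1 |>.trans (by
        rw [flip_innerₗ]; rfl)
  rw [e2] at e1
  calc ∫ x, g x • (𝓕 (h2.toLp f) : Lp ℂ 2 (volume : Measure V)) x
      = ∫ x, G x • (𝓕 (h2.toLp f) : Lp ℂ 2 (volume : Measure V)) x := by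
        simp only [hG, smul_eq_mul, Complex.real_smul]
    _ = ∫ x, (𝓕 (G : V → ℂ)) x • f x := by rw [e1]; rfl
    _ = _ := e3
    _ = ∫ x, g x • 𝓕 f x := by simp only [hG, smul_eq_mul, Complex.real_smul]

theorem lintegral_enorm_sq_toLp {α E : Type*} [MeasurableSpace α] [NormedAddCommGroup E]
    {μ : Measure α} (f : Lp E 2 μ) : ∫⁻ x, ‖f x‖ₑ ^ 2 ∂μ = ‖f‖ₑ ^ 2 := by
  rw [Lp.enorm_def, eLpNorm_eq_lintegral_rpow_enorm_toReal (by norm_num) (by norm_num),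
    ← ENNReal.rpow_natCast, ← ENNReal.rpow_mul]
  norm_num

theorem lintegral_enorm_sq_fourier {f : V → ℂ} (h1 : Integrable f) (h2 : MemLp f 2 volume) :
    ∫⁻ w, ‖𝓕 f w‖ₑ ^ 2 = ∫⁻ v, ‖f v‖ₑ ^ 2 := by
  calc ∫⁻ w, ‖𝓕 f w‖ₑ ^ 2 = ∫⁻ w, ‖(𝓕 (h2.toLp f) : Lp ℂ 2 (volume : Measure V)) w‖ₑ ^ 2 := by
        refine lintegral_congr_ae ?_
        filter_upwards [fourier_toLp_ae_eq h1 h2] with x hx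
        rw [hx]
    _ = ∫⁻ v, ‖(h2.toLp f) v‖ₑ ^ 2 := by
        rw [lintegral_enorm_sq_toLp, lintegral_enorm_sq_toLp, enorm_eq_iff_norm_eq.2
          (Lp.norm_fourier_eq _)]
    _ = _ := by
        refine lintegral_congr_ae ?_
        filter_upwards [h2.coeFn_toLp] with x hx
        rw [hx]

/-- Plancherel's theorem for `w ↦ ∫ e^{2πi⟨v, w⟩} f(v) dv`. -/
theorem lintegral_enorm_sq_integral_exp_mul {f : V → ℂ} (h1 : Integrable f)
    (h2 : MemLp f 2 volume) :
    ∫⁻ w, ‖∫ v, Complex.exp (2 * Real.pi * Complex.I * (inner ℝ v w : ℝ)) * f v‖ₑ ^ 2 =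
      ∫⁻ v, ‖f v‖ₑ ^ 2 := by
  -- The kernel here is `e^{+2πi⟨v,w⟩}`; the reflection `w ↦ -w` restores the sign of the Fourier
  -- transform.
  rw [← lintegral_enorm_sq_fourier h1 h2,
    ← (Measure.measurePreserving_neg (volume : Measure V)).lintegral_comp_emb
      (MeasurableEquiv.neg V).measurableEmbedding]
  refine lintegral_congr fun w => ?_
  rw [Real.fourier_eq']
  congr 3
  funext v
  rw [smul_eq_mul, inner_neg_right]
  congr 2
  push_cast
  ring

end Plancherel

/-! ### Countability of the Hilbert basis and weak measurability -/

/-- Orthonormal vectors are at distance `√2`, so the balls of radius `1/2` around them are disjoint,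
and a separable space admits only countably many disjoint nonempty open sets. -/
theorem countable_of_orthonormal {H ι : Type*} [NormedAddCommGroup H] [InnerProductSpace ℂ H]
    [TopologicalSpace.SeparableSpace H] {v : ι → H} (hv : Orthonormal ℂ v) : Countable ι := by
  refine Pairwise.countable_of_isOpen_disjoint (s := fun i => Metric.ball (v i) (1 / 2)) ?_
    (fun i => Metric.isOpen_ball) (fun i => ⟨v i, Metric.mem_ball_self (by norm_num)⟩)
  intro i j hij
  refine Metric.ball_disjoint_ball ?_
  have h : ‖v i - v j‖ ^ 2 = 2 := by
    rw [@norm_sub_sq ℂ, hv.1 i, hv.1 j, hv.2 hij]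
    norm_num
  rw [dist_eq_norm]
  nlinarith [norm_nonneg (v i - v j)]

instance countable_basisIndex (n : ℕ) : Countable (basisIndex n) := by
  have : Fact ((2 : ℝ≥0∞) ≠ ∞) := ⟨by norm_num⟩
  exact countable_of_orthonormal (basisL2 n).orthonormal

/-- In `L²(ℝⁿ)`, weak measurability implies strong measurability. -/
theorem aestronglyMeasurable_of_inner {n : ℕ} {α : Type*} [MeasurableSpace α] {μ : Measure α}
    {f : α → L2R n} (h : ∀ g : L2R n, AEStronglyMeasurable (fun a => inner ℂ g (f a)) μ) :
    AEStronglyMeasurable f μ := by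
  -- Countability of the basis matters here: it makes the filter of finite subsets countably
  -- generated.
  refine aestronglyMeasurable_of_tendsto_ae (u := (atTop : Filter (Finset (basisIndex n))))
    (f := fun s a => ∑ i ∈ s, (basisL2 n).repr (f a) i • basisL2 n i) ?_
    (ae_of_all _ fun a => (basisL2 n).hasSum_repr (f a))
  intro s
  refine Finset.aestronglyMeasurable_fun_sum s fun i _ => ?_
  simp only [HilbertBasis.repr_apply_apply]
  exact (h _).smul_const _

/-! ### Operators given by integrating the Schrödinger representation -/

theorem measurable_schrodingerFun {n : ℕ} (g : L2R n) :
    Measurable fun q : ℝ × Heis n × EuclideanSpace ℝ (Fin n) =>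
      schrodingerFun q.1 q.2.1 g q.2.2 := by
  unfold schrodingerFun
  refine Measurable.mul ?_ ((Lp.stronglyMeasurable g).measurable.comp (by fun_prop))
  refine Continuous.measurable ?_
  fun_prop

theorem norm_exp_two_pi_I_mul (a b : ℝ) :
    ‖Complex.exp (2 * Real.pi * Complex.I * a * b)‖ = 1 := by
  have : (2 * Real.pi * Complex.I * a * b : ℂ) = ((2 * Real.pi * a * b : ℝ) : ℂ) * Complex.I := by
    push_cast
    ring
  rw [this, Complex.norm_exp_ofReal_mul_I]

theorem norm_schrodingerFun {n : ℕ} (lam : ℝ) (p : Heis n) (g : EuclideanSpace ℝ (Fin n) → ℂ)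
    (ξ : EuclideanSpace ℝ (Fin n)) : ‖schrodingerFun lam p g ξ‖ = ‖g (ξ + p.2.1)‖ := by
  simp only [schrodingerFun, norm_mul, norm_exp_two_pi_I_mul, one_mul]

theorem norm_schrodinger {n : ℕ} (lam : ℝ) (p : Heis n) (g : L2R n) :
    ‖schrodinger lam p g‖ = ‖g‖ := by
  rw [schrodinger, Lp.norm_toLp, Lp.norm_def]
  congr 1
  rw [eLpNorm_congr_norm_ae (g := fun ξ => g (ξ + p.2.1))
    (ae_of_all _ fun ξ => by rw [norm_schrodingerFun])]
  exact eLpNorm_comp_measurePreserving (Lp.aestronglyMeasurable g)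
    (measurePreserving_add_right volume p.2.1)

theorem inner_schrodinger {n : ℕ} (lam : ℝ) (p : Heis n) (g h : L2R n) :
    inner ℂ h (schrodinger lam p g) = ∫ ξ, schrodingerFun lam p g ξ * starRingEnd ℂ (h ξ) := by
  rw [L2.inner_def]
  refine integral_congr_ae ?_
  filter_upwards [(memLp_schrodingerFun lam p g).coeFn_toLp] with ξ hξ
  rw [schrodinger, hξ]
  rfl

theorem stronglyMeasurable_inner_schrodinger {n : ℕ} (g h : L2R n) :
    StronglyMeasurable fun q : ℝ × Heis n => inner ℂ h (schrodinger q.1 q.2 g) := by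
  simp only [inner_schrodinger]
  refine StronglyMeasurable.integral_prod_right
    (f := fun (q : ℝ × Heis n) ξ => schrodingerFun q.1 q.2 g ξ * starRingEnd ℂ (h ξ)) ?_
  refine Measurable.stronglyMeasurable (Measurable.mul ?_ ?_)
  · exact (measurable_schrodingerFun g).comp
      (f := fun q : (ℝ × Heis n) × EuclideanSpace ℝ (Fin n) => (q.1.1, q.1.2, q.2)) (by fun_prop)
  · exact Complex.continuous_conj.measurable.comp
      ((Lp.stronglyMeasurable h).measurable.comp measurable_snd)

theorem aestronglyMeasurable_schrodinger {n : ℕ} (lam : ℝ) (g : L2R n) :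
    AEStronglyMeasurable (fun X => schrodinger lam X g) (volume : Measure (Heis n)) :=
  aestronglyMeasurable_of_inner fun h =>
    ((stronglyMeasurable_inner_schrodinger g h).comp_measurable
      (measurable_prodMk_left (x := lam))).aestronglyMeasurable

theorem integrable_smul_schrodinger {n : ℕ} {u : Heis n → ℂ} (hu : Integrable u) (lam : ℝ)
    (g : L2R n) : Integrable fun X => u X • schrodinger lam X g := by
  refine (hu.norm.mul_const ‖g‖).mono
    (hu.aestronglyMeasurable.smul (aestronglyMeasurable_schrodinger lam g)) (ae_of_all _ fun X => ?_)
  simp [norm_smul, norm_schrodinger]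

theorem inner_fourierL1 {n : ℕ} {u : Heis n → ℂ} (hu : Integrable u) (lam : ℝ) (g h : L2R n) :
    inner ℂ h (fourierL1 u lam g) = ∫ X, u X * inner ℂ h (schrodinger lam X g) := by
  rw [fourierL1, ← integral_inner (integrable_smul_schrodinger hu lam g)]
  simp only [inner_smul_right]

theorem fourierL1_congr {n : ℕ} {u v : Heis n → ℂ} (h : u =ᵐ[volume] v) :
    fourierL1 u = fourierL1 v := by
  funext lam g
  refine integral_congr_ae ?_
  filter_upwards [h] with X hX
  rw [hX]

theorem aestronglyMeasurable_fourierL1 {n : ℕ} {u : Heis n → ℂ} (hu : Integrable u) (g : L2R n)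
    {μ : Measure ℝ} [SFinite μ] : AEStronglyMeasurable (fun lam => fourierL1 u lam g) μ := by
  refine aestronglyMeasurable_of_inner fun h => ?_
  simp only [inner_fourierL1 hu]
  refine AEStronglyMeasurable.integral_prod_right'
    (f := fun q : ℝ × Heis n => u q.2 * inner ℂ h (schrodinger q.1 q.2 g)) ?_
  exact hu.aestronglyMeasurable.comp_snd.mul
    (stronglyMeasurable_inner_schrodinger g h).aestronglyMeasurable

/-- As `g` is only square integrable, integrability in `ξ` is available only on sets of finite
measure. There Cauchy–Schwarz bounds the `ξ`-integral of `|π_λ(X)g|` uniformly in `X`, which permits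
Fubini. -/
theorem integrable_prod_schrodingerFun {n : ℕ} {u : Heis n → ℂ} (hu : Integrable u) (lam : ℝ)
    (g : L2R n) {s : Set (EuclideanSpace ℝ (Fin n))} (hs : volume s ≠ ∞) :
    Integrable (fun q : Heis n × EuclideanSpace ℝ (Fin n) => u q.1 * schrodingerFun lam q.1 g q.2)
      (volume.prod (volume.restrict s)) := by
  have : IsFiniteMeasure (volume.restrict s) := ⟨by simpa using hs.lt_top⟩
  have hS : ∀ X : Heis n, MemLp (schrodingerFun lam X g) 2 (volume.restrict s) := fun X =>
    (memLp_schrodingerFun lam X g).restrict s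
  have hmeas : AEStronglyMeasurable (fun q : Heis n × EuclideanSpace ℝ (Fin n) =>
      u q.1 * schrodingerFun lam q.1 g q.2) (volume.prod (volume.restrict s)) := by
    refine hu.aestronglyMeasurable.comp_fst.mul (Measurable.aestronglyMeasurable ?_)
    exact (measurable_schrodingerFun g).comp
      (f := fun q : Heis n × EuclideanSpace ℝ (Fin n) => (lam, q)) measurable_prodMk_left
  refine (integrable_prod_iff hmeas).2 ⟨ae_of_all _ fun X => ?_, ?_⟩
  · exact ((hS X).integrable (by norm_num)).const_mul (u X)
  · refine (hu.norm.mul_const ((eLpNorm g 2 volume * volume.restrict s Set.univ ^ ((1 : ℝ) / 2)).toReal)).mono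
      hmeas.norm.integral_prod_right' (ae_of_all _ fun X => ?_)
    have h0 : 0 ≤ ∫ ξ in s, ‖u X * schrodingerFun lam X g ξ‖ :=
      integral_nonneg fun _ => norm_nonneg _
    rw [Real.norm_of_nonneg h0, norm_mul, norm_norm,
      Real.norm_of_nonneg ENNReal.toReal_nonneg]
    simp only [norm_mul]
    rw [integral_const_mul]
    refine mul_le_mul_of_nonneg_left ?_ (norm_nonneg _)
    rw [integral_norm_eq_lintegral_enorm (hS X).1, ← eLpNorm_one_eq_lintegral_enorm]
    refine ENNReal.toReal_mono (ENNReal.mul_ne_top (Lp.eLpNorm_ne_top g) ?_) ?_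
    · exact ENNReal.rpow_ne_top_of_nonneg (by norm_num) (measure_ne_top _ _)
    · have h1 := eLpNorm_le_eLpNorm_mul_rpow_measure_univ (p := 1) (q := 2) (by norm_num) (hS X).1
      refine h1.trans ?_
      norm_num
      gcongr
      refine (eLpNorm_mono_measure _ Measure.restrict_le_self).trans ?_
      have h2 := congrArg ENNReal.ofReal (norm_schrodinger lam X g)
      rw [schrodinger, Lp.norm_toLp, Lp.norm_def, ENNReal.ofReal_toReal
        (memLp_schrodingerFun lam X g).2.ne, ENNReal.ofReal_toReal (Lp.eLpNorm_ne_top g)] at h2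
      exact h2.le

/-- The operator `û(λ)` is given by the pointwise integral. -/
theorem fourierL1_ae_eq {n : ℕ} {u : Heis n → ℂ} (hu : Integrable u) (lam : ℝ) (g : L2R n) :
    fourierL1 u lam g =ᵐ[volume] fun ξ => ∫ X, u X * schrodingerFun lam X g ξ := by
  -- A Bochner integral in `L²` has no pointwise values, so integrals over sets of finite measure
  -- are compared: pairing with an indicator commutes with the Bochner integral, and Fubini does the
  -- rest.
  refine ae_eq_of_forall_setIntegral_eq_of_sigmaFinite (fun s hs hμ => ?_) (fun s hs hμ => ?_)
    (fun s hs hμ => ?_)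
  · have : IsFiniteMeasure (volume.restrict s) := ⟨by simpa using hμ⟩
    exact ((Lp.memLp (fourierL1 u lam g)).restrict s).integrable (by norm_num)
  · exact (integrable_prod_schrodingerFun hu lam g hμ.ne).integral_prod_right
  · have h1 := integral_integral_swap (f := fun X ξ => u X * schrodingerFun lam X g ξ)
      (integrable_prod_schrodingerFun hu lam g hμ.ne)
    rw [← L2.inner_indicatorConstLp_one (𝕜 := ℂ) hs hμ.ne, inner_fourierL1 hu, ← h1]
    refine integral_congr_ae (ae_of_all _ fun X => ?_)
    simp only
    rw [L2.inner_indicatorConstLp_one, integral_const_mul]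
    congr 1
    refine integral_congr_ae (ae_restrict_of_ae ?_)
    exact (memLp_schrodingerFun lam X g).coeFn_toLp

theorem ae_integrable_mul_schrodingerFun {n : ℕ} {u : Heis n → ℂ} (hu : Integrable u) (lam : ℝ)
    (g : L2R n) : ∀ᵐ ξ, Integrable fun X => u X * schrodingerFun lam X g ξ := by
  refine ae_of_forall_measure_lt_top_ae_restrict _ fun s hs hμ => ?_
  exact (integrable_prod_schrodingerFun hu lam g hμ.ne).prod_left_ae

/-! ### Plancherel's theorem on the Heisenberg group for `L¹ ∩ L²` -/

section Tonelli

variable {A B C : Type*} [MeasureSpace A] [MeasureSpace B] [MeasureSpace C]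

theorem lintegral_prod_prod [SFinite (volume : Measure B)] [SFinite (volume : Measure C)]
    {f : A × B × C → ℝ≥0∞} (hf : Measurable f) :
    ∫⁻ X, f X = ∫⁻ x, ∫⁻ y, ∫⁻ t, f (x, y, t) := by
  rw [Measure.volume_eq_prod, lintegral_prod _ hf.aemeasurable]
  refine lintegral_congr fun x => ?_
  have hx : Measurable fun q => f (x, q) := hf.comp measurable_prodMk_left
  rw [Measure.volume_eq_prod, lintegral_prod _ hx.aemeasurable]

theorem lintegral_prod_prod_left [SFinite (volume : Measure A)]
    [SFinite (volume : Measure B)] [SFinite (volume : Measure C)] {f : A × B × C → ℝ≥0∞} (hf : Measurable f) :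
    ∫⁻ X, f X = ∫⁻ q : B × C, ∫⁻ x, f (x, q) := by
  rw [Measure.volume_eq_prod, lintegral_prod_symm _ hf.aemeasurable]

theorem lintegral_prod_prod_mid [SFinite (volume : Measure A)]
    [SFinite (volume : Measure B)] [SFinite (volume : Measure C)] {f : A × B × C → ℝ≥0∞} (hf : Measurable f) :
    ∫⁻ X, f X = ∫⁻ y, ∫⁻ x, ∫⁻ t, f (x, y, t) := by
  rw [lintegral_prod_prod hf, lintegral_lintegral_swap]
  exact (hf.comp (f := fun q : (A × B) × C => (q.1.1, q.1.2, q.2))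
    (by fun_prop)).lintegral_prod_right'.aemeasurable

theorem lintegral_prod_prod_right [SFinite (volume : Measure A)]
    [SFinite (volume : Measure B)] [SFinite (volume : Measure C)] {f : A × B × C → ℝ≥0∞} (hf : Measurable f) :
    ∫⁻ X, f X = ∫⁻ t, ∫⁻ y, ∫⁻ x, f (x, y, t) := by
  rw [lintegral_prod_prod_left hf, Measure.volume_eq_prod, lintegral_prod_symm]
  exact hf.lintegral_prod_left'.aemeasurable

theorem lintegral_enorm_sq_eq_of_memLp {E : Type*} [NormedAddCommGroup E] {f : A → E}
    (hf : MemLp f 2 volume) : ∫⁻ x, ‖f x‖ₑ ^ 2 = ‖hf.toLp f‖ₑ ^ 2 := by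
  rw [← lintegral_enorm_sq_toLp]
  refine lintegral_congr_ae ?_
  filter_upwards [hf.coeFn_toLp] with x hx
  rw [hx]

theorem lintegral_enorm_sq_ne_top {E : Type*} [NormedAddCommGroup E] {f : A → E}
    (hf : MemLp f 2 volume) : ∫⁻ x, ‖f x‖ₑ ^ 2 ≠ ∞ := by
  rw [lintegral_enorm_sq_eq_of_memLp hf]
  exact (ENNReal.pow_lt_top enorm_lt_top).ne

theorem memLp_two_of_lintegral_lt_top {E : Type*} [NormedAddCommGroup E] {f : A → E}
    (hf : AEStronglyMeasurable f volume) (h : ∫⁻ x, ‖f x‖ₑ ^ 2 < ∞) : MemLp f 2 volume := by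
  refine ⟨hf, ?_⟩
  rw [eLpNorm_lt_top_iff_lintegral_rpow_enorm_lt_top (by norm_num) (by norm_num)]
  simpa using h

end Tonelli

/-- The Fourier transform of `u` in the central variable. -/
def centralFourier {n : ℕ} (u : Heis n → ℂ) (x y : EuclideanSpace ℝ (Fin n)) (lam : ℝ) : ℂ :=
  ∫ t : ℝ, Complex.exp (2 * Real.pi * Complex.I * lam * t) * u (x, y, t)

/-- The Fourier transform of `u` in the first and the central variable. -/
def partialFourier {n : ℕ} (u : Heis n → ℂ) (w y : EuclideanSpace ℝ (Fin n)) (lam : ℝ) : ℂ :=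
  ∫ x, Complex.exp (2 * Real.pi * Complex.I * (inner ℝ x w : ℝ)) * centralFourier u x y lam

section

variable {n : ℕ} {u : Heis n → ℂ}

theorem measurable_centralFourier (hm : Measurable u) :
    Measurable fun q : EuclideanSpace ℝ (Fin n) × EuclideanSpace ℝ (Fin n) × ℝ =>
      centralFourier u q.1 q.2.1 q.2.2 := by
  refine (StronglyMeasurable.integral_prod_right'
    (f := fun q : (EuclideanSpace ℝ (Fin n) × EuclideanSpace ℝ (Fin n) × ℝ) × ℝ =>
      Complex.exp (2 * Real.pi * Complex.I * q.1.2.2 * q.2) * u (q.1.1, q.1.2.1, q.2)) ?_).measurable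
  exact (Measurable.mul (by fun_prop) (hm.comp (by fun_prop))).stronglyMeasurable

theorem measurable_partialFourier (hm : Measurable u) :
    Measurable fun q : EuclideanSpace ℝ (Fin n) × EuclideanSpace ℝ (Fin n) × ℝ =>
      partialFourier u q.1 q.2.1 q.2.2 := by
  refine (StronglyMeasurable.integral_prod_right'
    (f := fun q : (EuclideanSpace ℝ (Fin n) × EuclideanSpace ℝ (Fin n) × ℝ) ×
      EuclideanSpace ℝ (Fin n) =>
      Complex.exp (2 * Real.pi * Complex.I * (inner ℝ q.2 q.1.1 : ℝ)) *
        centralFourier u q.2 q.1.2.1 q.1.2.2) ?_).measurable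
  refine (Measurable.mul (Continuous.measurable (by fun_prop)) ?_).stronglyMeasurable
  exact (measurable_centralFourier hm).comp
    (f := fun q : (EuclideanSpace ℝ (Fin n) × EuclideanSpace ℝ (Fin n) × ℝ) ×
      EuclideanSpace ℝ (Fin n) => (q.2, q.1.2.1, q.1.2.2)) (by fun_prop)

theorem ae_ae_integrable_central {E : Type*} [NormedAddCommGroup E] {v : Heis n → E}
    (hv : Integrable v) : ∀ᵐ x, ∀ᵐ y, Integrable fun t : ℝ => v (x, y, t) := by
  have h1 : Integrable v (volume.prod (volume.prod volume)) := hv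
  filter_upwards [h1.prod_right_ae] with x hx
  exact hx.prod_right_ae

theorem lintegral_centralFourier (hm : Measurable u) (h1 : Integrable u) (h2 : MemLp u 2 volume) :
    ∫⁻ x, ∫⁻ y, ∫⁻ lam, ‖centralFourier u x y lam‖ₑ ^ 2 = ∫⁻ X, ‖u X‖ₑ ^ 2 := by
  rw [lintegral_prod_prod (hm.enorm.pow_const 2)]
  have h2' : Integrable fun X => ‖u X‖ ^ 2 :=
    (memLp_two_iff_integrable_sq_norm h2.1).1 h2
  refine lintegral_congr_ae ?_
  filter_upwards [ae_ae_integrable_central h1, ae_ae_integrable_central h2'] with x hx hx2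
  refine lintegral_congr_ae ?_
  filter_upwards [hx, hx2] with y hy hy2
  rw [← lintegral_enorm_sq_integral_exp_mul hy ((memLp_two_iff_integrable_sq_norm hy.1).2 hy2)]
  refine lintegral_congr fun lam => ?_
  unfold centralFourier
  congr 3
  funext t
  congr 2
  simp
  ring

theorem lintegral_prod_centralFourier (hm : Measurable u) (h1 : Integrable u)
    (h2 : MemLp u 2 volume) :
    ∫⁻ q : EuclideanSpace ℝ (Fin n) × ℝ, ∫⁻ x, ‖centralFourier u x q.1 q.2‖ₑ ^ 2 =
      ∫⁻ X, ‖u X‖ₑ ^ 2 := by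
  have hm2 := (measurable_centralFourier hm).enorm.pow_const 2
  rw [← lintegral_centralFourier hm h1 h2]
  exact (lintegral_prod_prod_left hm2).symm.trans (lintegral_prod_prod hm2)

/-- Supplies the `L¹` hypothesis for the second use of Plancherel's theorem, in the variable `x`:
the central transform is dominated by the integral of `|u|` over `t`. -/
theorem ae_integrable_centralFourier (hm : Measurable u) (h1 : Integrable u) :
    ∀ᵐ q : EuclideanSpace ℝ (Fin n) × ℝ, Integrable fun x => centralFourier u x q.1 q.2 := by
  have key : ∀ᵐ y : EuclideanSpace ℝ (Fin n), ∫⁻ x, ∫⁻ t, ‖u (x, y, t)‖ₑ < ∞ := by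
    refine ae_lt_top ?_ ?_
    · refine Measurable.lintegral_prod_right (f := fun y x => ∫⁻ t, ‖u (x, y, t)‖ₑ) ?_
      refine Measurable.lintegral_prod_right (f := fun (q : EuclideanSpace ℝ (Fin n) ×
        EuclideanSpace ℝ (Fin n)) t => ‖u (q.2, q.1, t)‖ₑ) ?_
      exact (hm.comp (by fun_prop)).enorm
    · rw [← lintegral_prod_prod_mid hm.enorm]
      exact h1.2.ne
  filter_upwards [Measure.quasiMeasurePreserving_fst.ae key] with q hq
  refine ⟨((measurable_centralFourier hm).comp (f := fun x => (x, q)) (by fun_prop)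
    ).aestronglyMeasurable, lt_of_le_of_lt (lintegral_mono fun x => ?_) hq⟩
  refine (enorm_integral_le_lintegral_enorm _).trans (lintegral_mono fun t => le_of_eq ?_)
  rw [enorm_mul, enorm_eq_iff_norm_eq.2 ((norm_exp_two_pi_I_mul q.2 t).trans (norm_one (α := ℂ)).symm)]
  simp

theorem lintegral_partialFourier (hm : Measurable u) (h1 : Integrable u) (h2 : MemLp u 2 volume) :
    ∫⁻ lam, ∫⁻ y, ∫⁻ w, ‖partialFourier u w y lam‖ₑ ^ 2 = ∫⁻ X, ‖u X‖ₑ ^ 2 := by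
  have hm2 := (measurable_partialFourier hm).enorm.pow_const 2
  have hm3 := (measurable_centralFourier hm).enorm.pow_const 2
  rw [← lintegral_prod_centralFourier hm h1 h2]
  have hfin : ∀ᵐ q : EuclideanSpace ℝ (Fin n) × ℝ,
      ∫⁻ x, ‖centralFourier u x q.1 q.2‖ₑ ^ 2 < ∞ := by
    refine ae_lt_top hm3.lintegral_prod_left' ?_
    rw [lintegral_prod_centralFourier hm h1 h2]
    exact lintegral_enorm_sq_ne_top h2
  have e : ∫⁻ q : EuclideanSpace ℝ (Fin n) × ℝ, ∫⁻ x, ‖centralFourier u x q.1 q.2‖ₑ ^ 2 =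
      ∫⁻ q : EuclideanSpace ℝ (Fin n) × ℝ, ∫⁻ w, ‖partialFourier u w q.1 q.2‖ₑ ^ 2 := by
    refine lintegral_congr_ae ?_
    filter_upwards [hfin, ae_integrable_centralFourier hm h1] with q hq hq1
    exact (lintegral_enorm_sq_integral_exp_mul hq1 (memLp_two_of_lintegral_lt_top hq1.1 hq)).symm
  rw [e]
  exact (lintegral_prod_prod_right hm2).symm.trans (lintegral_prod_prod_left hm2)

/-- The weight `|λ|ⁿ` of the Plancherel measure is exactly the Jacobian of the dilation by `λ`. -/
theorem lintegral_comp_smul {f : EuclideanSpace ℝ (Fin n) → ℝ≥0∞} (hf : Measurable f) {lam : ℝ}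
    (hl : lam ≠ 0) : ENNReal.ofReal (|lam| ^ n) * ∫⁻ ξ, f (lam • ξ) = ∫⁻ w, f w := by
  rw [← lintegral_map (g := fun ξ : EuclideanSpace ℝ (Fin n) => lam • ξ) hf (by fun_prop),
    Measure.map_addHaar_smul _ hl, lintegral_smul_measure, smul_eq_mul, ← mul_assoc,
    ← ENNReal.ofReal_mul (by positivity)]
  simp only [finrank_euclideanSpace, Fintype.card_fin, abs_inv, abs_pow]
  rw [mul_inv_cancel₀ (pow_ne_zero _ (abs_ne_zero.2 hl))]
  simp

/-- `Q(ξ, y)`, where `û(λ) g (ξ) = ∫ Q(ξ, y) g(ξ + y) dy`. -/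
def fourierKernel (u : Heis n → ℂ) (lam : ℝ) (ξ y : EuclideanSpace ℝ (Fin n)) : ℂ :=
  partialFourier u (lam • (ξ + (1 / 2 : ℝ) • y)) y lam

theorem measurable_fourierKernel (hm : Measurable u) :
    Measurable fun q : ℝ × EuclideanSpace ℝ (Fin n) × EuclideanSpace ℝ (Fin n) =>
      fourierKernel u q.1 q.2.1 q.2.2 :=
  (measurable_partialFourier hm).comp
    (f := fun q : ℝ × EuclideanSpace ℝ (Fin n) × EuclideanSpace ℝ (Fin n) =>
      (q.1 • (q.2.1 + (1 / 2 : ℝ) • q.2.2), q.2.2, q.1)) (by fun_prop)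

theorem lintegral_fourierKernel (hm : Measurable u) {lam : ℝ} (hl : lam ≠ 0) :
    ENNReal.ofReal (|lam| ^ n) * ∫⁻ ξ, ∫⁻ y, ‖fourierKernel u lam ξ y‖ₑ ^ 2 =
      ∫⁻ y, ∫⁻ w, ‖partialFourier u w y lam‖ₑ ^ 2 := by
  have hm2 : Measurable fun q : EuclideanSpace ℝ (Fin n) × EuclideanSpace ℝ (Fin n) =>
      ‖fourierKernel u lam q.1 q.2‖ₑ ^ 2 :=
    ((measurable_fourierKernel hm).comp measurable_prodMk_left).enorm.pow_const 2
  rw [lintegral_lintegral_swap (f := fun ξ y => ‖fourierKernel u lam ξ y‖ₑ ^ 2) hm2.aemeasurable,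
    ← lintegral_const_mul _ hm2.lintegral_prod_left']
  refine lintegral_congr fun y => ?_
  have hy : Measurable fun w => ‖partialFourier u w y lam‖ₑ ^ 2 :=
    ((measurable_partialFourier hm).comp (f := fun w => (w, y, lam))
      (by fun_prop)).enorm.pow_const 2
  rw [← lintegral_comp_smul hy hl]
  congr 1
  exact lintegral_add_right_eq_self
    (fun ξ => ‖partialFourier u (lam • ξ) y lam‖ₑ ^ 2) ((1 / 2 : ℝ) • y)

/-- The phase regroups as `λt + ⟨x, λ(ξ + y/2)⟩`, so integrating over `t` and `x` leaves a partial
Fourier transform at the frequencies `λ` and `λ(ξ + y/2)`. -/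
theorem integral_mul_schrodingerFun {lam : ℝ} {g : L2R n} {ξ : EuclideanSpace ℝ (Fin n)}
    (h : Integrable fun X => u X * schrodingerFun lam X g ξ) :
    ∫ X, u X * schrodingerFun lam X g ξ = ∫ y, fourierKernel u lam ξ y * g (ξ + y) := by
  let F : Heis n → ℂ := fun X => u X * schrodingerFun lam X g ξ
  have hF : Integrable (fun q : (EuclideanSpace ℝ (Fin n) × EuclideanSpace ℝ (Fin n)) × ℝ =>
      F (q.1.1, q.1.2, q.2)) :=
    (volume_preserving_prodAssoc.integrable_comp_emb
      MeasurableEquiv.prodAssoc.measurableEmbedding).2 h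
  have e1 : ∫ X, F X = ∫ q : (EuclideanSpace ℝ (Fin n) × EuclideanSpace ℝ (Fin n)) × ℝ,
      F (q.1.1, q.1.2, q.2) :=
    (volume_preserving_prodAssoc.integral_comp'
      (f := MeasurableEquiv.prodAssoc (α := EuclideanSpace ℝ (Fin n))) F).symm
  have hF' := hF
  rw [Measure.volume_eq_prod] at hF'
  have hF2 := hF'.integral_prod_left
  rw [Measure.volume_eq_prod] at hF2
  change ∫ X, F X = _
  rw [e1, Measure.volume_eq_prod, integral_prod _ hF', Measure.volume_eq_prod,
    integral_prod_symm _ hF2]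
  refine integral_congr_ae (ae_of_all _ fun y => ?_)
  simp only [fourierKernel, partialFourier, centralFourier, F, schrodingerFun]
  rw [← integral_mul_const]
  refine integral_congr_ae (ae_of_all _ fun x => ?_)
  simp only
  rw [← integral_const_mul, ← integral_mul_const]
  refine integral_congr_ae (ae_of_all _ fun t => ?_)
  simp only [inner_smul_right, inner_add_right]
  have e : ∀ a b c d : ℂ, a * (b * c * d) = c * (b * a) * d := fun a b c d => by ring
  rw [e]
  congr 3
  push_cast
  ring

theorem hasSum_norm_sq_inner {H ι : Type*} [NormedAddCommGroup H] [InnerProductSpace ℂ H]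
    (b : HilbertBasis ι ℂ H) (x : H) : ∑' i, ‖inner ℂ x (b i)‖ₑ ^ 2 = ‖x‖ₑ ^ 2 := by
  have h1 : HasSum (fun i => ‖inner ℂ x (b i)‖ ^ 2) (‖x‖ ^ 2) := by
    have h := b.hasSum_inner_mul_inner x x
    have h' := Complex.hasSum_re h
    have e0 : (inner ℂ x x).re = ‖x‖ ^ 2 := (norm_sq_eq_re_inner (𝕜 := ℂ) x).symm
    rw [e0] at h'
    convert h' using 2 with i
    rw [← inner_conj_symm (b i) x, Complex.mul_conj, Complex.ofReal_re, Complex.normSq_eq_norm_sq]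
  have h2 := ENNReal.ofReal_tsum_of_nonneg (fun i => by positivity) h1.summable
  rw [h1.tsum_eq] at h2
  have e : ∀ r : ℂ, ENNReal.ofReal (‖r‖ ^ 2) = ‖r‖ₑ ^ 2 := fun r => by
    rw [ENNReal.ofReal_pow (norm_nonneg _), ofReal_norm]
  simp only [e] at h2
  rw [← h2, ENNReal.ofReal_pow (norm_nonneg _), ofReal_norm]

/-- Parseval's identity for the function `η ↦ conj (q (η - ξ))`. -/
theorem tsum_enorm_sq_integral_mul_basis {q : EuclideanSpace ℝ (Fin n) → ℂ} (hq : MemLp q 2 volume)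
    (ξ : EuclideanSpace ℝ (Fin n)) :
    ∑' i, ‖∫ y, q y * basisL2 n i (ξ + y)‖ₑ ^ 2 = ∫⁻ y, ‖q y‖ₑ ^ 2 := by
  have hmp := measurePreserving_sub_right (volume : Measure (EuclideanSpace ℝ (Fin n))) ξ
  have hh : MemLp (fun η => starRingEnd ℂ (q (η - ξ))) 2 volume :=
    (hq.comp_measurePreserving hmp).star
  have e1 : ∫⁻ y, ‖q y‖ₑ ^ 2 = ‖hh.toLp _‖ₑ ^ 2 := by
    rw [← lintegral_enorm_sq_toLp, ← lintegral_sub_right_eq_self (fun y => ‖q y‖ₑ ^ 2) ξ]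
    refine lintegral_congr_ae ?_
    filter_upwards [hh.coeFn_toLp] with η hη
    rw [hη]
    simp
  rw [e1, ← hasSum_norm_sq_inner (basisL2 n)]
  congr 1
  funext i
  congr 2
  rw [L2.inner_def, ← integral_sub_right_eq_self _ ξ]
  refine integral_congr_ae ?_
  filter_upwards [hh.coeFn_toLp] with η hη
  rw [hη, RCLike.inner_apply]
  simp [mul_comm]

/-- The sum over the basis is taken inside the `ξ`-integral, where Parseval in `y` applies for a.e.
`ξ`; finiteness makes a.e. slice of the kernel square integrable. -/
theorem hsNormSq_fourierL1 (hm : Measurable u) (h1 : Integrable u) {lam : ℝ}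
    (hfin : ∫⁻ ξ, ∫⁻ y, ‖fourierKernel u lam ξ y‖ₑ ^ 2 ≠ ∞) :
    hsNormSq (fourierL1 u lam) = ∫⁻ ξ, ∫⁻ y, ‖fourierKernel u lam ξ y‖ₑ ^ 2 := by
  have hmk : Measurable fun q : EuclideanSpace ℝ (Fin n) × EuclideanSpace ℝ (Fin n) =>
      fourierKernel u lam q.1 q.2 := (measurable_fourierKernel hm).comp
    (f := fun q : EuclideanSpace ℝ (Fin n) × EuclideanSpace ℝ (Fin n) => (lam, q)) (by fun_prop)
  have hmk2 := hmk.enorm.pow_const 2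
  have hae : ∀ᵐ ξ, ∫⁻ y, ‖fourierKernel u lam ξ y‖ₑ ^ 2 < ∞ :=
    ae_lt_top hmk2.lintegral_prod_right' hfin
  have e : ∀ i, ‖fourierL1 u lam (basisL2 n i)‖ₑ ^ 2 =
      ∫⁻ ξ, ‖∫ y, fourierKernel u lam ξ y * basisL2 n i (ξ + y)‖ₑ ^ 2 := by
    intro i
    rw [← lintegral_enorm_sq_toLp]
    refine lintegral_congr_ae ?_
    filter_upwards [fourierL1_ae_eq h1 lam (basisL2 n i),
      ae_integrable_mul_schrodingerFun h1 lam (basisL2 n i)] with ξ h3 h4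
    rw [h3, integral_mul_schrodingerFun h4]
  unfold hsNormSq
  simp only [e]
  rw [← lintegral_tsum]
  · refine lintegral_congr_ae ?_
    filter_upwards [hae] with ξ hξ
    have hξm : Measurable fun y => fourierKernel u lam ξ y :=
      hmk.comp (f := fun y => (ξ, y)) (by fun_prop)
    exact tsum_enorm_sq_integral_mul_basis
      (memLp_two_of_lintegral_lt_top hξm.aestronglyMeasurable hξ) ξ
  · intro i
    refine Measurable.aemeasurable ((StronglyMeasurable.measurable ?_).enorm.pow_const 2)
    refine StronglyMeasurable.integral_prod_right
      (f := fun ξ y => fourierKernel u lam ξ y * basisL2 n i (ξ + y)) (Measurable.stronglyMeasurable ?_)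
    exact hmk.mul ((Lp.stronglyMeasurable _).measurable.comp (by fun_prop))

theorem lintegral_hsNormSq_fourierL1_of_measurable (hm : Measurable u) (h1 : Integrable u)
    (h2 : MemLp u 2 volume) :
    ∫⁻ lam : ℝ, hsNormSq (fourierL1 u lam) * ENNReal.ofReal (|lam| ^ n) = ∫⁻ X, ‖u X‖ₑ ^ 2 := by
  rw [← lintegral_partialFourier hm h1 h2]
  have hm2 := (measurable_partialFourier hm).enorm.pow_const 2
  have hfin : ∀ᵐ lam : ℝ, ∫⁻ y, ∫⁻ w, ‖partialFourier u w y lam‖ₑ ^ 2 < ∞ := by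
    refine ae_lt_top ?_ ?_
    · have hm3 : Measurable fun q : EuclideanSpace ℝ (Fin n) × ℝ =>
          ∫⁻ w, ‖partialFourier u w q.1 q.2‖ₑ ^ 2 := hm2.lintegral_prod_left'
      exact hm3.lintegral_prod_left'
    · rw [lintegral_partialFourier hm h1 h2]
      exact lintegral_enorm_sq_ne_top h2
  refine lintegral_congr_ae ?_
  filter_upwards [hfin, Measure.ae_ne volume 0] with lam hlam h0
  rw [← lintegral_fourierKernel hm h0] at hlam ⊢
  have h0' : ENNReal.ofReal (|lam| ^ n) ≠ 0 := by
    have := abs_pos.2 h0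
    simp only [ne_eq, ENNReal.ofReal_eq_zero, not_le]
    positivity
  rw [hsNormSq_fourierL1 hm h1 (ENNReal.lt_top_of_mul_ne_top_right hlam.ne h0').ne, mul_comm]

/-- Plancherel's theorem on the Heisenberg group, for functions in `L¹ ∩ L²`. -/
theorem lintegral_hsNormSq_fourierL1 (h1 : Integrable u) (h2 : MemLp u 2 volume) :
    ∫⁻ lam : ℝ, hsNormSq (fourierL1 u lam) * ENNReal.ofReal (|lam| ^ n) = ∫⁻ X, ‖u X‖ₑ ^ 2 := by
  obtain ⟨v, hv, huv⟩ := h1.1.aemeasurable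
  rw [fourierL1_congr huv, lintegral_hsNormSq_fourierL1_of_measurable hv (h1.congr huv)
    ((memLp_congr_ae huv).1 h2)]
  refine lintegral_congr_ae ?_
  filter_upwards [huv] with X hX
  rw [hX]

end

/-! ### The group Fourier transform as an isometry -/

theorem eLpNorm_two_sq {α E : Type*} [MeasurableSpace α] [NormedAddCommGroup E] (μ : Measure α)
    (f : α → E) : eLpNorm f 2 μ ^ 2 = ∫⁻ x, ‖f x‖ₑ ^ 2 ∂μ := by
  rw [eLpNorm_eq_lintegral_rpow_enorm_toReal (by norm_num) (by norm_num),
    ← ENNReal.rpow_natCast, ← ENNReal.rpow_mul]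
  norm_num

theorem tendsto_sq_zero_iff {u : ℕ → ℝ≥0∞} :
    Tendsto (fun j => u j ^ 2) atTop (𝓝 0) ↔ Tendsto u atTop (𝓝 0) := by
  constructor
  · intro h
    have h2 := (ENNReal.continuous_rpow_const (y := (1 / 2 : ℝ))).tendsto 0 |>.comp h
    rw [ENNReal.zero_rpow_of_pos (by norm_num)] at h2
    refine h2.congr fun j => ?_
    simp only [Function.comp]
    rw [← ENNReal.rpow_natCast, ← ENNReal.rpow_mul]
    norm_num
  · intro h
    have h2 := (ENNReal.continuous_pow 2).tendsto 0 |>.comp h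
    rw [zero_pow two_ne_zero] at h2
    exact h2

instance measurableSpaceBasisIndex (n : ℕ) : MeasurableSpace (basisIndex n) := ⊤

instance discreteMeasurableSpaceBasisIndex (n : ℕ) : DiscreteMeasurableSpace (basisIndex n) :=
  ⟨fun _ => trivial⟩

/-- The Plancherel measure `|λ|ⁿ dλ`. -/
def plancherelMeasure (n : ℕ) : Measure ℝ :=
  volume.withDensity fun lam => ENNReal.ofReal (|lam| ^ n)

/-- The product of the Plancherel measure and the counting measure on the Hilbert basis. An
operator-valued function `F` is Hilbert-Schmidt square integrable iff `(λ, i) ↦ F(λ) eᵢ` is square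
integrable for this measure. -/
def hsMeasure (n : ℕ) : Measure (ℝ × basisIndex n) :=
  Measure.sum fun i => (plancherelMeasure n).map fun lam => (lam, i)

/-- The function `(λ, i) ↦ F(λ) eᵢ`. -/
def coordFun {n : ℕ} (F : ℝ → L2R n → L2R n) (q : ℝ × basisIndex n) : L2R n :=
  F q.1 (basisL2 n q.2)

theorem measurable_weight (n : ℕ) :
    Measurable fun lam : ℝ => ENNReal.ofReal (|lam| ^ n) := by fun_prop

/-- The weight `|λ|ⁿ` vanishes at most at `λ = 0`, so both measures have the same null sets. -/
theorem ae_plancherelMeasure_iff {n : ℕ} {p : ℝ → Prop} :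
    (∀ᵐ lam ∂plancherelMeasure n, p lam) ↔ ∀ᵐ lam : ℝ, p lam := by
  rw [plancherelMeasure, ae_withDensity_iff (measurable_weight n)]
  refine ⟨fun h => ?_, fun h => h.mono fun _ h _ => h⟩
  filter_upwards [h, Measure.ae_ne volume 0] with lam h1 h0
  refine h1 ?_
  have := abs_pos.2 h0
  simp only [ne_eq, ENNReal.ofReal_eq_zero, not_le]
  positivity

theorem ae_hsMeasure_iff {n : ℕ} {p : ℝ × basisIndex n → Prop} :
    (∀ᵐ q ∂hsMeasure n, p q) ↔ ∀ᵐ lam : ℝ, ∀ i, p (lam, i) := by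
  rw [hsMeasure, Measure.ae_sum_iff, ae_all_iff]
  refine forall_congr' fun i => ?_
  rw [(measurableEmbedding_prod_mk_right i).ae_map_iff, ae_plancherelMeasure_iff]

theorem aestronglyMeasurable_plancherel_iff {n : ℕ} {E : Type*} [NormedAddCommGroup E] {f : ℝ → E} :
    AEStronglyMeasurable f (plancherelMeasure n) ↔ AEStronglyMeasurable f volume := by
  constructor
  · rintro ⟨g, hg, h⟩
    exact ⟨g, hg, ae_plancherelMeasure_iff.1 h⟩
  · rintro ⟨g, hg, h⟩
    exact ⟨g, hg, ae_plancherelMeasure_iff.2 h⟩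

theorem aestronglyMeasurable_hsMeasure_iff {n : ℕ} {E : Type*} [NormedAddCommGroup E]
    {f : ℝ × basisIndex n → E} :
    AEStronglyMeasurable f (hsMeasure n) ↔
      ∀ i, AEStronglyMeasurable (fun lam => f (lam, i)) volume := by
  rw [hsMeasure, aestronglyMeasurable_sum_measure_iff]
  refine forall_congr' fun i => ?_
  rw [(measurableEmbedding_prod_mk_right i).aestronglyMeasurable_map_iff,
    aestronglyMeasurable_plancherel_iff]
  rfl

theorem lintegral_plancherelMeasure {n : ℕ} {f : ℝ → ℝ≥0∞} (hf : AEMeasurable f) :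
    ∫⁻ lam, f lam ∂plancherelMeasure n = ∫⁻ lam, f lam * ENNReal.ofReal (|lam| ^ n) := by
  rw [plancherelMeasure, lintegral_withDensity_eq_lintegral_mul₀ (measurable_weight n).aemeasurable hf]
  refine lintegral_congr fun lam => ?_
  rw [Pi.mul_apply, mul_comm]

theorem lintegral_hsMeasure {n : ℕ} {f : ℝ × basisIndex n → ℝ≥0∞}
    (hf : ∀ i, AEMeasurable (fun lam => f (lam, i))) :
    ∫⁻ q, f q ∂hsMeasure n = ∫⁻ lam, (∑' i, f (lam, i)) * ENNReal.ofReal (|lam| ^ n) := by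
  rw [hsMeasure, lintegral_sum_measure]
  simp only [(measurableEmbedding_prod_mk_right _).lintegral_map,
    lintegral_plancherelMeasure (hf _), ← ENNReal.tsum_mul_right]
  exact (lintegral_tsum fun i => (hf i).mul (measurable_weight n).aemeasurable).symm

theorem lintegral_coordFun {n : ℕ} {F : ℝ → L2R n → L2R n}
    (hF : AEStronglyMeasurable (coordFun F) (hsMeasure n)) :
    ∫⁻ q, ‖coordFun F q‖ₑ ^ 2 ∂hsMeasure n =
      ∫⁻ lam : ℝ, hsNormSq (F lam) * ENNReal.ofReal (|lam| ^ n) :=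
  lintegral_hsMeasure fun i => (aestronglyMeasurable_hsMeasure_iff.1 hF i).enorm.pow_const 2

theorem memLp_hsMeasure {n : ℕ} {f : ℝ × basisIndex n → L2R n}
    (hf : AEStronglyMeasurable f (hsMeasure n)) (h : ∫⁻ q, ‖f q‖ₑ ^ 2 ∂hsMeasure n < ∞) :
    MemLp f 2 (hsMeasure n) := by
  refine ⟨hf, ?_⟩
  rw [eLpNorm_lt_top_iff_lintegral_rpow_enorm_lt_top (by norm_num) (by norm_num)]
  simpa using h

theorem aestronglyMeasurable_coordFun_fourierL1 {n : ℕ} {u : Heis n → ℂ} (hu : Integrable u) :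
    AEStronglyMeasurable (coordFun (fourierL1 u)) (hsMeasure n) :=
  aestronglyMeasurable_hsMeasure_iff.2 fun i =>
    aestronglyMeasurable_fourierL1 hu (basisL2 n i) (μ := volume)

theorem lintegral_coordFun_fourierL1 {n : ℕ} {u : Heis n → ℂ} (hu : Integrable u)
    (hu2 : MemLp u 2 volume) :
    ∫⁻ q, ‖coordFun (fourierL1 u) q‖ₑ ^ 2 ∂hsMeasure n = ∫⁻ X, ‖u X‖ₑ ^ 2 := by
  rw [lintegral_coordFun (aestronglyMeasurable_coordFun_fourierL1 hu),
    lintegral_hsNormSq_fourierL1 hu hu2]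

theorem memLp_coordFun_fourierL1 {n : ℕ} {u : Heis n → ℂ} (hu : Integrable u)
    (hu2 : MemLp u 2 volume) : MemLp (coordFun (fourierL1 u)) 2 (hsMeasure n) := by
  refine memLp_hsMeasure (aestronglyMeasurable_coordFun_fourierL1 hu) ?_
  rw [lintegral_coordFun_fourierL1 hu hu2]
  exact (lintegral_enorm_sq_ne_top hu2).lt_top

/-- The space `L¹ ∩ L²` of functions on the Heisenberg group. -/
def L1L2 (n : ℕ) : Submodule ℂ (Heis n → ℂ) where
  carrier := {u | Integrable u volume ∧ MemLp u 2 volume}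
  add_mem' h h' := ⟨h.1.add h'.1, h.2.add h'.2⟩
  zero_mem' := ⟨integrable_zero _ _ _, MemLp.zero⟩
  smul_mem' c _ h := ⟨Integrable.smul c h.1, h.2.const_smul c⟩

theorem fourierL1_add {n : ℕ} {u v : Heis n → ℂ} (hu : Integrable u) (hv : Integrable v) (lam : ℝ)
    (g : L2R n) : fourierL1 (u + v) lam g = fourierL1 u lam g + fourierL1 v lam g := by
  unfold fourierL1
  rw [← integral_add (integrable_smul_schrodinger hu lam g) (integrable_smul_schrodinger hv lam g)]
  simp only [Pi.add_apply, add_smul]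

theorem fourierL1_smul {n : ℕ} (c : ℂ) (u : Heis n → ℂ) (lam : ℝ)
    (g : L2R n) : fourierL1 (c • u) lam g = c • fourierL1 u lam g := by
  unfold fourierL1
  rw [← integral_smul]
  simp only [Pi.smul_apply, smul_assoc]

/-- The inclusion of `L¹ ∩ L²` in `L²`. -/
def inclL2 (n : ℕ) : L1L2 n →ₗ[ℂ] Lp ℂ 2 (volume : Measure (Heis n)) where
  toFun u := u.2.2.toLp u.1
  map_add' _ _ := rfl
  map_smul' _ _ := rfl

/-- The Fourier transform on `L¹ ∩ L²`. -/
def fourierL1L2 (n : ℕ) : L1L2 n →ₗ[ℂ] Lp (L2R n) 2 (hsMeasure n) where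
  toFun u := (memLp_coordFun_fourierL1 u.2.1 u.2.2).toLp _
  map_add' u v := by
    rw [← MemLp.toLp_add]
    refine MemLp.toLp_congr _ _ (ae_of_all _ fun q => ?_)
    exact fourierL1_add u.2.1 v.2.1 _ _
  map_smul' c u := by
    rw [RingHom.id_apply, ← MemLp.toLp_const_smul]
    refine MemLp.toLp_congr _ _ (ae_of_all _ fun q => ?_)
    exact fourierL1_smul c u.1 _ _

theorem norm_fourierL1L2 {n : ℕ} (u : L1L2 n) : ‖fourierL1L2 n u‖ = ‖inclL2 n u‖ := by
  refine (enorm_eq_iff_norm_eq.1 ?_)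
  have h1 : ‖fourierL1L2 n u‖ₑ = eLpNorm (coordFun (fourierL1 u.1)) 2 (hsMeasure n) :=
    Lp.enorm_toLp (memLp_coordFun_fourierL1 u.2.1 u.2.2)
  have h2 : ‖inclL2 n u‖ₑ = eLpNorm u.1 2 volume := Lp.enorm_toLp u.2.2
  rw [h1, h2]
  refine ENNReal.rpow_left_injective (x := 2) two_ne_zero ?_
  simp only [ENNReal.rpow_two]
  rw [eLpNorm_two_sq, eLpNorm_two_sq, lintegral_coordFun_fourierL1 u.2.1 u.2.2]

theorem exists_L1L2_tendsto {n : ℕ} {f : Heis n → ℂ} (hf : MemLp f 2 volume) :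
    ∃ u : ℕ → L1L2 n, Tendsto (fun j => eLpNorm ((u j).1 - f) 2 volume) atTop (𝓝 0) := by
  have h : ∀ j : ℕ, ∃ u : L1L2 n, eLpNorm (u.1 - f) 2 volume ≤ (j + 1 : ℝ≥0∞)⁻¹ := by
    intro j
    obtain ⟨g, hgs, hg, hgc, hg2⟩ := hf.exists_hasCompactSupport_eLpNorm_sub_le (by norm_num)
      (ε := (j + 1 : ℝ≥0∞)⁻¹) (by simp)
    exact ⟨⟨g, hgc.integrable_of_hasCompactSupport hgs, hg2⟩, by rwa [eLpNorm_sub_comm]⟩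
  choose u hu using h
  refine ⟨u, tendsto_of_tendsto_of_tendsto_of_le_of_le tendsto_const_nhds ?_
    (fun _ => zero_le) hu⟩
  have := ENNReal.tendsto_inv_nat_nhds_zero.comp (tendsto_add_atTop_nat 1)
  refine this.congr fun j => ?_
  simp

theorem tendsto_inclL2 {n : ℕ} {f : Heis n → ℂ} (hf : MemLp f 2 volume) {u : ℕ → L1L2 n}
    (hu : Tendsto (fun j => eLpNorm ((u j).1 - f) 2 volume) atTop (𝓝 0)) :
    Tendsto (fun j => inclL2 n (u j)) atTop (𝓝 (hf.toLp f)) :=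
  (Lp.tendsto_Lp_iff_tendsto_eLpNorm'' (fun j => (u j).1) (fun j => (u j).2.2) f hf).2 hu

theorem denseRange_inclL2 (n : ℕ) : DenseRange (inclL2 n) := by
  intro f
  obtain ⟨u, hu⟩ := exists_L1L2_tendsto (Lp.memLp f)
  have h := tendsto_inclL2 (Lp.memLp f) hu
  rw [Lp.toLp_coeFn] at h
  exact mem_closure_of_tendsto h (Eventually.of_forall fun j => ⟨u j, rfl⟩)

/-- A continuous linear extension of a densely defined isometry is an isometry. -/
theorem norm_extendOfNorm_eq {E H K : Type*} [AddCommGroup E] [Module ℂ E] [NormedAddCommGroup H]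
    [NormedSpace ℂ H] [NormedAddCommGroup K] [NormedSpace ℂ K] [CompleteSpace K]
    {f : E →ₗ[ℂ] K} {e : E →ₗ[ℂ] H} (he : DenseRange e) (h : ∀ x, ‖f x‖ = ‖e x‖) (y : H) :
    ‖f.extendOfNorm e y‖ = ‖y‖ := by
  refine DenseRange.induction_on (p := fun y => ‖f.extendOfNorm e y‖ = ‖y‖) he y ?_ fun x => ?_
  · exact isClosed_eq (by fun_prop) (by fun_prop)
  · rw [LinearMap.extendOfNorm_eq he ⟨1, fun x => by rw [one_mul, h]⟩, h]

/-- The group Fourier transform `f ↦ ((λ, i) ↦ f̂(λ) eᵢ)` as an isometry. -/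
def fourierIso (n : ℕ) :
    Lp ℂ 2 (volume : Measure (Heis n)) →ₗᵢ[ℂ] Lp (L2R n) 2 (hsMeasure n) where
  toLinearMap := ((fourierL1L2 n).extendOfNorm (inclL2 n)).toLinearMap
  norm_map' := norm_extendOfNorm_eq (denseRange_inclL2 n) norm_fourierL1L2

theorem fourierIso_inclL2 {n : ℕ} (u : L1L2 n) :
    fourierIso n (inclL2 n u) = fourierL1L2 n u :=
  LinearMap.extendOfNorm_eq (denseRange_inclL2 n)
    ⟨1, fun x => by rw [one_mul, norm_fourierL1L2]⟩ u

theorem IsFourierL2.aestronglyMeasurable {n : ℕ} {f : Heis n → ℂ} {F : ℝ → L2R n →L[ℂ] L2R n}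
    (h : IsFourierL2 f F) :
    AEStronglyMeasurable (coordFun fun lam => ⇑(F lam)) (hsMeasure n) :=
  aestronglyMeasurable_hsMeasure_iff.2 fun i => h.1 (basisL2 n i)

theorem IsFourierL2.memLp {n : ℕ} {f : Heis n → ℂ} {F : ℝ → L2R n →L[ℂ] L2R n}
    (h : IsFourierL2 f F) : MemLp (coordFun fun lam => ⇑(F lam)) 2 (hsMeasure n) := by
  refine memLp_hsMeasure h.aestronglyMeasurable ?_
  rw [lintegral_coordFun h.aestronglyMeasurable]
  exact h.2.1

theorem tendsto_hsNormSq_iff {n : ℕ} {F : ℝ → L2R n →L[ℂ] L2R n}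
    (hF : AEStronglyMeasurable (coordFun fun lam => ⇑(F lam)) (hsMeasure n)) (u : ℕ → L1L2 n) :
    Tendsto (fun j => ∫⁻ lam : ℝ, hsNormSq (fun g => fourierL1 (u j).1 lam g - F lam g) *
      ENNReal.ofReal (|lam| ^ n)) atTop (𝓝 0) ↔
    Tendsto (fun j => eLpNorm (coordFun (fourierL1 (u j).1) - coordFun fun lam => ⇑(F lam)) 2
      (hsMeasure n)) atTop (𝓝 0) := by
  rw [← tendsto_sq_zero_iff (u := fun j => eLpNorm _ 2 (hsMeasure n))]
  refine iff_of_eq (congrArg (fun v => Tendsto v atTop (𝓝 0)) (funext fun j => ?_))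
  rw [eLpNorm_two_sq]
  exact (lintegral_coordFun (F := fun lam g => fourierL1 (u j).1 lam g - F lam g)
    ((aestronglyMeasurable_coordFun_fourierL1 (u j).2.1).sub hF)).symm

/-- Uniqueness of the transform: every operator-valued representative has the same coordinates a.e.,
so the choice made in `fourierL2` is harmless. -/
theorem IsFourierL2.coordFun_ae_eq {n : ℕ} {f : Heis n → ℂ} (hf : MemLp f 2 volume)
    {F : ℝ → L2R n →L[ℂ] L2R n} (h : IsFourierL2 f F) :
    fourierIso n (hf.toLp f) = h.memLp.toLp _ := by
  obtain ⟨u, hu, hu1, hu2⟩ := h.2.2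
  let v : ℕ → L1L2 n := fun j => ⟨u j, hu j⟩
  have h1 := ((fourierIso n).continuous.tendsto _).comp (tendsto_inclL2 hf (u := v) hu1)
  refine tendsto_nhds_unique h1 ?_
  simp only [Function.comp_def, fourierIso_inclL2]
  exact (Lp.tendsto_Lp_iff_tendsto_eLpNorm'' (fun j => coordFun (fourierL1 (v j).1))
    (fun j => memLp_coordFun_fourierL1 (v j).2.1 (v j).2.2) _ h.memLp).2
    ((tendsto_hsNormSq_iff h.aestronglyMeasurable v).1 hu2)

/-- Square summable columns `v i` define a bounded operator by Cauchy–Schwarz. This turns coordinate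
functions back into operators. -/
theorem exists_operator_of_summable {H ι : Type*} [NormedAddCommGroup H] [InnerProductSpace ℂ H]
    [CompleteSpace H] (b : HilbertBasis ι ℂ H) {v : ι → H} (hv : Summable fun i => ‖v i‖ ^ 2) :
    ∃ T : H →L[ℂ] H, ∀ g, HasSum (fun i => inner ℂ (b i) g • v i) (T g) := by
  have key : ∀ g, Summable (fun i => ‖inner ℂ (b i) g‖ * ‖v i‖) ∧
      ∑' i, ‖inner ℂ (b i) g‖ * ‖v i‖ ≤ ‖g‖ * √(∑' i, ‖v i‖ ^ 2) := by
    intro g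
    have h2 := b.orthonormal.inner_products_summable g
    obtain ⟨h3, h4⟩ := Real.summable_and_inner_le_Lp_mul_Lq_tsum_of_nonneg (p := 2) (q := 2)
      (f := fun i => ‖inner ℂ (b i) g‖) (g := fun i => ‖v i‖) Real.HolderConjugate.two_two
      (fun i => norm_nonneg _) (fun i => norm_nonneg _) (by simpa using h2) (by simpa using hv)
    refine ⟨h3, h4.trans ?_⟩
    simp only [Real.rpow_two, ← Real.sqrt_eq_rpow]
    refine mul_le_mul_of_nonneg_right ?_ (Real.sqrt_nonneg _)
    exact Real.sqrt_le_iff.2 ⟨norm_nonneg _, b.orthonormal.tsum_inner_products_le g⟩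
  have hs : ∀ g, Summable fun i => inner ℂ (b i) g • v i := fun g =>
    Summable.of_norm (by simpa only [norm_smul] using (key g).1)
  let T : H →ₗ[ℂ] H :=
    { toFun := fun g => ∑' i, inner ℂ (b i) g • v i
      map_add' := fun g h => by
        rw [← (hs g).tsum_add (hs h)]
        simp only [inner_add_right, add_smul]
      map_smul' := fun c g => by
        rw [RingHom.id_apply, ← (hs g).tsum_const_smul]
        simp only [inner_smul_right, mul_smul] }
  refine ⟨T.mkContinuous (√(∑' i, ‖v i‖ ^ 2)) fun g => ?_, fun g => (hs g).hasSum⟩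
  rw [mul_comm]
  refine le_trans ?_ (key g).2
  refine (norm_tsum_le_tsum_norm (by simpa only [norm_smul] using (key g).1)).trans ?_
  simp only [norm_smul, le_refl]

theorem exists_isFourierL2 {n : ℕ} {f : Heis n → ℂ} (hf : MemLp f 2 volume) :
    ∃ F, IsFourierL2 f F := by
  classical
  let Φ := fourierIso n (hf.toLp f)
  have hΦ : ∀ i, AEStronglyMeasurable (fun lam => Φ (lam, i)) volume :=
    aestronglyMeasurable_hsMeasure_iff.1 (Lp.aestronglyMeasurable Φ)
  have hsum : ∀ᵐ lam : ℝ, Summable fun i => ‖Φ (lam, i)‖ ^ 2 := by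
    have h1 := lintegral_enorm_sq_toLp Φ
    rw [lintegral_hsMeasure fun i => (hΦ i).enorm.pow_const 2] at h1
    have h2 : ∀ᵐ lam : ℝ, (∑' i, ‖Φ (lam, i)‖ₑ ^ 2) * ENNReal.ofReal (|lam| ^ n) < ∞ := by
      refine ae_lt_top' ?_ ?_
      · exact (AEMeasurable.tsum fun i => (hΦ i).enorm.pow_const 2).mul
          (measurable_weight n).aemeasurable
      · rw [h1]
        exact (ENNReal.pow_lt_top enorm_lt_top).ne
    filter_upwards [h2, Measure.ae_ne volume 0] with lam hlam h0
    have h0' : ENNReal.ofReal (|lam| ^ n) ≠ 0 := by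
      have := abs_pos.2 h0
      simp only [ne_eq, ENNReal.ofReal_eq_zero, not_le]
      positivity
    have h3 := (ENNReal.lt_top_of_mul_ne_top_left hlam.ne h0').ne
    have h4 := ENNReal.summable_toReal h3
    refine h4.congr fun i => ?_
    simp
  -- For a.e. `λ` the columns are square summable and assemble to an operator; on the exceptional
  -- null set the value is `0`.
  let F : ℝ → L2R n →L[ℂ] L2R n := fun lam =>
    if h : Summable fun i => ‖Φ (lam, i)‖ ^ 2 then
      (exists_operator_of_summable (basisL2 n) h).choose else 0
  have hF : ∀ᵐ lam : ℝ, ∀ g, HasSum (fun i => inner ℂ (basisL2 n i) g • Φ (lam, i)) (F lam g) := by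
    filter_upwards [hsum] with lam h
    simp only [F, h, dif_pos]
    exact (exists_operator_of_summable (basisL2 n) h).choose_spec
  have hcoord : coordFun (fun lam => ⇑(F lam)) =ᵐ[hsMeasure n] Φ := by
    refine ae_hsMeasure_iff.2 ?_
    filter_upwards [hF] with lam h i
    refine (h (basisL2 n i)).unique ?_
    have h1 := hasSum_ite_eq i (Φ (lam, i))
    refine h1.congr_fun fun j => ?_
    rw [orthonormal_iff_ite.1 (basisL2 n).orthonormal j i]
    split_ifs with hij
    · rw [hij, one_smul]
    · rw [zero_smul]
  have hm : AEStronglyMeasurable (coordFun fun lam => ⇑(F lam)) (hsMeasure n) :=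
    (Lp.aestronglyMeasurable Φ).congr hcoord.symm
  have hmem : MemLp (coordFun fun lam => ⇑(F lam)) 2 (hsMeasure n) :=
    (memLp_congr_ae hcoord).2 (Lp.memLp Φ)
  refine ⟨F, fun g => ?_, ?_, ?_⟩
  · refine aestronglyMeasurable_of_tendsto_ae (u := (atTop : Filter (Finset (basisIndex n))))
      (f := fun s lam => ∑ i ∈ s, inner ℂ (basisL2 n i) g • Φ (lam, i)) ?_ ?_
    · exact fun s => Finset.aestronglyMeasurable_fun_sum s fun i _ =>
        (hΦ i).const_smul (inner ℂ (basisL2 n i) g)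
    · filter_upwards [hF] with lam h
      exact h g
  · rw [← lintegral_coordFun hm, ← eLpNorm_two_sq]
    exact ENNReal.pow_lt_top hmem.2
  · obtain ⟨u, hu⟩ := exists_L1L2_tendsto hf
    refine ⟨fun j => (u j).1, fun j => (u j).2, hu, (tendsto_hsNormSq_iff hm u).2 ?_⟩
    have h1 := ((fourierIso n).continuous.tendsto _).comp (tendsto_inclL2 hf hu)
    refine (Lp.tendsto_Lp_iff_tendsto_eLpNorm'' (fun j => coordFun (fourierL1 (u j).1))
      (fun j => memLp_coordFun_fourierL1 (u j).2.1 (u j).2.2) _ hmem).1 ?_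
    have h2 : hmem.toLp _ = Φ := by
      rw [← Lp.toLp_coeFn Φ (Lp.memLp Φ)]
      exact MemLp.toLp_congr _ _ hcoord
    rw [h2]
    simp only [Function.comp_def, fourierIso_inclL2] at h1
    exact h1

theorem isFourierL2_fourierL2 {n : ℕ} {f : Heis n → ℂ} (hf : MemLp f 2 volume) :
    IsFourierL2 f (fourierL2 f) := by
  have h := exists_isFourierL2 hf
  rw [fourierL2, dif_pos h]
  exact h.choose_spec

/-! ### Translations and the Fourier transform -/

theorem leftTranslate_leftTranslate {n : ℕ} (p q : Heis n) (f : Heis n → ℂ) :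
    leftTranslate p (leftTranslate q f) = leftTranslate (hmul p q) f := by
  funext X
  unfold leftTranslate
  rw [← hmul_assoc]
  congr 2
  refine Prod.ext ?_ (Prod.ext ?_ ?_)
  · simp [hmul, hinv, add_comm]
  · simp [hmul, hinv, add_comm]
  · simp only [hmul, hinv, inner_neg_right, inner_neg_left, real_inner_comm]
    ring

theorem leftTranslate_central_apply {n : ℕ} (c : ℝ) (f : Heis n → ℂ) (X : Heis n) :
    leftTranslate (0, 0, c) f X = f (X - (0, 0, c)) := by
  obtain ⟨x, y, t⟩ := X
  rw [leftTranslate_apply]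
  simp

theorem latticePt_zero_zero {n : ℕ} (m : ℤ) : latticePt (n := n) 0 0 m = (0, 0, (m : ℝ)) := by
  unfold latticePt
  refine Prod.ext ?_ (Prod.ext ?_ rfl)
  · ext i
    simp
  · ext i
    simp

theorem hmul_central_latticePt {n : ℕ} (k l : Fin n → ℤ) (m m' : ℤ) :
    hmul (0, 0, (m : ℝ)) (latticePt k l m') = latticePt k l (m + m') := by
  refine Prod.ext ?_ (Prod.ext ?_ ?_) <;> simp [hmul, latticePt]

theorem leftTranslate_zero {n : ℕ} (f : Heis n → ℂ) : leftTranslate 0 f = f := by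
  have h := leftTranslate_central_apply (n := n) 0 f
  funext X
  have e : ((0, 0, 0) : Heis n) = 0 := rfl
  rw [e] at h
  rw [h, sub_zero X]

theorem leftTranslate_lattice_central {n : ℕ} (k l : Fin n → ℤ) (m m' : ℤ) (f : Heis n → ℂ) :
    leftTranslate (0, 0, (m : ℝ)) (leftTranslate (latticePt k l m') f) =
      leftTranslate (latticePt k l (m + m')) f := by
  rw [leftTranslate_leftTranslate, hmul_central_latticePt]

/-- The character `e^{2πimλ}` on the real line. -/
def chr (m : ℤ) (lam : ℝ) : ℂ := Complex.exp (2 * Real.pi * Complex.I * lam * (m : ℝ))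

theorem norm_chr (m : ℤ) (lam : ℝ) : ‖chr m lam‖ = 1 := norm_exp_two_pi_I_mul lam m

theorem enorm_chr (m : ℤ) (lam : ℝ) : ‖chr m lam‖ₑ = 1 := by
  rw [← ofReal_norm, norm_chr, ENNReal.ofReal_one]

theorem continuous_chr (m : ℤ) : Continuous (chr m) := by
  unfold chr
  fun_prop

theorem chr_eq_fourier (m : ℤ) (lam : ℝ) : chr m lam = fourier m (lam : AddCircle (1 : ℝ)) := by
  rw [fourier_coe_apply, chr]
  congr 1
  push_cast
  ring

theorem chr_add_intCast (m r : ℤ) (lam : ℝ) : chr m (lam + r) = chr m lam := by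
  rw [chr_eq_fourier, chr_eq_fourier]
  congr 1
  rw [QuotientAddGroup.eq]
  exact AddSubgroup.mem_zmultiples_iff.2 ⟨-r, by simp⟩

theorem schrodinger_add_central {n : ℕ} (lam : ℝ) (X : Heis n) (m : ℤ) (g : L2R n) :
    schrodinger lam (X + (0, 0, (m : ℝ))) g = chr m lam • schrodinger lam X g := by
  unfold schrodinger
  rw [← MemLp.toLp_const_smul]
  refine MemLp.toLp_congr _ _ (ae_of_all _ fun ξ => ?_)
  obtain ⟨x, y, t⟩ := X
  simp only [schrodingerFun, chr, Prod.fst_add, Prod.snd_add, add_zero, Pi.smul_apply, smul_eq_mul]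
  rw [← mul_assoc, ← mul_assoc, ← Complex.exp_add, ← Complex.exp_add, ← Complex.exp_add]
  congr 2
  push_cast
  ring

theorem measurePreserving_add_central {n : ℕ} (c : ℝ) :
    MeasurePreserving (fun X : Heis n => X + (0, 0, c)) volume volume := by
  convert measurePreserving_hmul (n := n) (0, 0, c) using 2 with X
  refine Prod.ext ?_ (Prod.ext ?_ ?_) <;> simp [hmul, add_comm]

theorem fourierL1_leftTranslate_central {n : ℕ} (u : Heis n → ℂ) (m : ℤ) (lam : ℝ) (g : L2R n) :
    fourierL1 (leftTranslate (0, 0, (m : ℝ)) u) lam g = chr m lam • fourierL1 u lam g := by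
  unfold fourierL1
  rw [← integral_smul, ← (measurePreserving_add_central (m : ℝ)).integral_comp
    (Homeomorph.addRight ((0, 0, (m : ℝ)) : Heis n)).measurableEmbedding]
  refine integral_congr_ae (ae_of_all _ fun X => ?_)
  simp only [leftTranslate_central_apply, add_sub_cancel_right, schrodinger_add_central]
  rw [smul_comm]

theorem integrable_leftTranslate {n : ℕ} (p : Heis n) {f : Heis n → ℂ} (hf : Integrable f) :
    Integrable (leftTranslate p f) :=
  (measurePreserving_hmul (hinv p)).integrable_comp_of_integrable hf

theorem hsNormSq_smul_of_norm_one {n : ℕ} {c : ℂ} (hc : ‖c‖ₑ = 1) (T : L2R n → L2R n) :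
    hsNormSq (fun g => c • T g) = hsNormSq T := by
  simp only [hsNormSq, enorm_smul, hc, one_mul]

/-- Central elements act by the unimodular scalars `chr m lam`, so the translated approximating
sequence has the twisted transforms and all norms are unchanged. -/
theorem IsFourierL2.leftTranslate_central {n : ℕ} {f : Heis n → ℂ} {F : ℝ → L2R n →L[ℂ] L2R n}
    (hf : MemLp f 2 volume) (h : IsFourierL2 f F) (m : ℤ) :
    IsFourierL2 (leftTranslate (0, 0, (m : ℝ)) f) (fun lam => chr m lam • F lam) := by
  obtain ⟨h1, h2, u, hu, hu1, hu2⟩ := h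
  refine ⟨fun g => (continuous_chr m).aestronglyMeasurable.smul (h1 g), ?_,
    fun j => leftTranslate (0, 0, (m : ℝ)) (u j), fun j => ⟨integrable_leftTranslate _ (hu j).1,
      memLp_leftTranslate _ (hu j).2⟩, ?_, ?_⟩
  · refine lt_of_eq_of_lt (lintegral_congr fun lam => ?_) h2
    exact congrArg (· * _) (hsNormSq_smul_of_norm_one (enorm_chr m lam) (F lam))
  · refine hu1.congr fun j => ?_
    exact (eLpNorm_comp_measurePreserving ((hu j).2.sub hf).1
      (measurePreserving_hmul (hinv (0, 0, (m : ℝ))))).symm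
  · refine hu2.congr fun j => lintegral_congr fun lam => ?_
    rw [← hsNormSq_smul_of_norm_one (enorm_chr m lam)]
    simp only [fourierL1_leftTranslate_central, smul_sub]
    rfl

/-! ### The integral formula for Hilbert-Schmidt inner products -/

theorem integral_plancherelMeasure {n : ℕ} (f : ℝ → ℂ) :
    ∫ lam, f lam ∂plancherelMeasure n = ∫ lam, f lam * ((|lam| ^ n : ℝ) : ℂ) := by
  rw [plancherelMeasure, integral_withDensity_eq_integral_toReal_smul (measurable_weight n)
    (ae_of_all _ fun _ => ENNReal.ofReal_lt_top)]
  refine integral_congr_ae (ae_of_all _ fun lam => ?_)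
  simp only
  rw [ENNReal.toReal_ofReal (by positivity), Complex.real_smul, mul_comm]

theorem integrable_tsum_of_lintegral {α ι : Type*} [MeasurableSpace α] [Countable ι]
    {μ : Measure α} {f : ι → α → ℂ} (hf : ∀ i, AEStronglyMeasurable (f i) μ)
    (h : ∫⁻ a, ∑' i, ‖f i a‖ₑ ∂μ ≠ ∞) :
    Integrable (fun a => ∑' i, f i a) μ ∧ ∫ a, ∑' i, f i a ∂μ = ∑' i, ∫ a, f i a ∂μ := by
  have hae : ∀ᵐ a ∂μ, ∑' i, ‖f i a‖ₑ < ∞ :=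
    ae_lt_top' (AEMeasurable.tsum fun i => (hf i).enorm) h
  have hs : ∀ᵐ a ∂μ, Summable fun i => f i a := by
    filter_upwards [hae] with a ha
    refine Summable.of_norm ?_
    have := ENNReal.summable_toReal ha.ne
    simpa using this
  refine ⟨⟨?_, ?_⟩, integral_tsum hf ?_⟩
  · refine aestronglyMeasurable_of_tendsto_ae (u := (atTop : Filter (Finset ι)))
      (f := fun s a => ∑ i ∈ s, f i a) ?_ ?_
    · exact fun s => Finset.aestronglyMeasurable_fun_sum s fun i _ => hf i
    · filter_upwards [hs] with a ha
      exact ha.hasSum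
  · exact lt_of_le_of_lt (lintegral_mono fun a => enorm_tsum_le_tsum_enorm) h.lt_top
  · rwa [← lintegral_tsum fun i => (hf i).enorm]

theorem integral_hsMeasure {n : ℕ} {h : ℝ × basisIndex n → ℂ} (hh : Integrable h (hsMeasure n)) :
    Integrable (fun lam : ℝ => (∑' i, h (lam, i)) * ((|lam| ^ n : ℝ) : ℂ)) ∧
      ∫ q, h q ∂hsMeasure n = ∫ lam : ℝ, (∑' i, h (lam, i)) * ((|lam| ^ n : ℝ) : ℂ) := by
  have hm := aestronglyMeasurable_hsMeasure_iff.1 hh.1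
  have e : ∀ lam : ℝ, ‖((|lam| ^ n : ℝ) : ℂ)‖ₑ = ENNReal.ofReal (|lam| ^ n) := fun lam => by
    rw [← ofReal_norm, Complex.norm_real, Real.norm_of_nonneg (by positivity)]
  have hfin : ∫⁻ lam : ℝ, ∑' i, ‖h (lam, i) * ((|lam| ^ n : ℝ) : ℂ)‖ₑ ≠ ∞ := by
    have h1 := hh.2
    rw [HasFiniteIntegral, lintegral_hsMeasure fun i => (hm i).enorm] at h1
    simp only [enorm_mul, e, ENNReal.tsum_mul_right]
    exact h1.ne
  have hm2 : ∀ i, AEStronglyMeasurable fun lam : ℝ => h (lam, i) * ((|lam| ^ n : ℝ) : ℂ) := fun i =>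
    (hm i).mul (Continuous.aestronglyMeasurable (by fun_prop))
  obtain ⟨h1, h2⟩ := integrable_tsum_of_lintegral hm2 hfin
  simp only [tsum_mul_right] at h1 h2
  refine ⟨h1, ?_⟩
  rw [h2]
  have h3 : Integrable h (Measure.sum fun i => (plancherelMeasure n).map fun lam => (lam, i)) := hh
  rw [hsMeasure, integral_sum_measure h3]
  refine tsum_congr fun i => ?_
  rw [(measurableEmbedding_prod_mk_right i).integral_map, integral_plancherelMeasure]

/-- Polarized Plancherel. Arbitrary representatives are allowed so that the transform of a central
translate can be taken as `chr m lam • F lam`, not as the one chosen by `fourierL2`. -/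
theorem integral_hsInner {n : ℕ} {f f' : Heis n → ℂ} (hf : MemLp f 2 volume)
    (hf' : MemLp f' 2 volume) {F F' : ℝ → L2R n →L[ℂ] L2R n} (hF : IsFourierL2 f F)
    (hF' : IsFourierL2 f' F') :
    Integrable (fun lam : ℝ => hsInner (F lam) (F' lam) * ((|lam| ^ n : ℝ) : ℂ)) ∧
      ∫ lam : ℝ, hsInner (F lam) (F' lam) * ((|lam| ^ n : ℝ) : ℂ) =
        inner ℂ (hf'.toLp f') (hf.toLp f) := by
  have e : (fun q => inner ℂ (hF'.memLp.toLp _ q) (hF.memLp.toLp _ q)) =ᵐ[hsMeasure n]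
      fun q => inner ℂ (coordFun (fun lam => ⇑(F' lam)) q) (coordFun (fun lam => ⇑(F lam)) q) := by
    filter_upwards [hF.memLp.coeFn_toLp, hF'.memLp.coeFn_toLp] with q h1 h2
    rw [h1, h2]
  have hint := (L2.integrable_inner (𝕜 := ℂ) (hF'.memLp.toLp _) (hF.memLp.toLp _)).congr e
  obtain ⟨h1, h2⟩ := integral_hsMeasure hint
  refine ⟨h1, ?_⟩
  rw [← (fourierIso n).inner_map_map, hF.coordFun_ae_eq hf, hF'.coordFun_ae_eq hf', L2.inner_def,
    integral_congr_ae e, h2]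
  rfl

theorem hsInner_smul_right {n : ℕ} (c : ℂ) (S T : L2R n → L2R n) :
    hsInner S (fun g => c • T g) = conj c * hsInner S T := by
  simp only [hsInner, inner_smul_left, tsum_mul_left]

/-- The density `⟨φ̂(λ), (L_{(2k,l,0)}φ)^(λ)⟩ |λ|ⁿ`, whose periodization is `G^φ_{k,l}`. -/
def crossDensity {n : ℕ} (φ : Heis n → ℂ) (k l : Fin n → ℤ) (lam : ℝ) : ℂ :=
  hsInner (fourierL2 φ lam) (fourierL2 (leftTranslate (latticePt k l 0) φ) lam) *
    ((|lam| ^ n : ℝ) : ℂ)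

theorem integrable_crossDensity {n : ℕ} {φ : Heis n → ℂ} (hφ : MemLp φ 2 volume)
    (k l : Fin n → ℤ) : Integrable (crossDensity φ k l) :=
  (integral_hsInner hφ (memLp_leftTranslate _ hφ) (isFourierL2_fourierL2 hφ)
    (isFourierL2_fourierL2 (memLp_leftTranslate _ hφ))).1

/-- Since `(2k,l,m) = (0,0,m)(2k,l,0)`, passing from `0` to `m` only multiplies the density by a
conjugate character. -/
theorem integral_crossDensity {n : ℕ} {φ : Heis n → ℂ} (hφ : MemLp φ 2 volume)
    (k l : Fin n → ℤ) (m : ℤ) :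
    ∫ lam, conj (chr m lam) * crossDensity φ k l lam =
      inner ℂ (translateLp (latticePt k l m) φ hφ) (hφ.toLp φ) := by
  have hφ' := memLp_leftTranslate (latticePt k l 0) hφ
  have h := (integral_hsInner hφ (memLp_leftTranslate (0, 0, (m : ℝ)) hφ')
    (isFourierL2_fourierL2 hφ)
    ((isFourierL2_fourierL2 hφ').leftTranslate_central hφ' m)).2
  have e : (memLp_leftTranslate (0, 0, (m : ℝ)) hφ').toLp _ =
      translateLp (latticePt k l m) φ hφ := by
    refine MemLp.toLp_congr _ _ (ae_of_all _ fun X => ?_)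
    rw [leftTranslate_lattice_central, add_zero]
  rw [e] at h
  rw [← h]
  refine integral_congr_ae (ae_of_all _ fun lam => ?_)
  simp only [crossDensity]
  rw [← mul_assoc, ← hsInner_smul_right]
  rfl

/-! ### Periodization -/

theorem pairwise_disjoint_Ioc_int :
    Pairwise (Function.onFun Disjoint fun r : ℤ => Set.Ioc (r : ℝ) (r + 1)) := by
  simpa using Set.pairwise_disjoint_Ioc_intCast ℝ

theorem preimage_add_Ioc_int (r : ℤ) :
    (fun x : ℝ => x + r) ⁻¹' Set.Ioc (r : ℝ) (r + 1) = Set.Ioc 0 1 := by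
  ext x
  simp only [Set.mem_preimage, Set.mem_Ioc]
  constructor <;> rintro ⟨h1, h2⟩ <;> constructor <;> linarith

theorem aemeasurable_comp_add {E : Type*} [MeasurableSpace E] {h : ℝ → E} (hh : AEMeasurable h)
    (r : ℝ) : AEMeasurable fun x => h (x + r) :=
  hh.comp_quasiMeasurePreserving (measurePreserving_add_right volume r).quasiMeasurePreserving

theorem lintegral_eq_lintegral_periodization {h : ℝ → ℝ≥0∞} (hh : AEMeasurable h) :
    ∫⁻ x, h x = ∫⁻ x in Set.Ioc 0 1, ∑' r : ℤ, h (x + r) := by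
  rw [← setLIntegral_univ, ← iUnion_Ioc_intCast ℝ,
    lintegral_iUnion (fun _ => measurableSet_Ioc) pairwise_disjoint_Ioc_int,
    lintegral_tsum fun r : ℤ => (aemeasurable_comp_add hh (r : ℝ)).restrict]
  refine tsum_congr fun r => ?_
  rw [← (measurePreserving_add_right (volume : Measure ℝ) (r : ℝ)).setLIntegral_comp_preimage_emb
    (measurableEmbedding_addRight _), preimage_add_Ioc_int]

theorem integral_eq_integral_periodization {h : ℝ → ℂ} (hh : Integrable h) :
    ∫ x, h x = ∫ x in Set.Ioc 0 1, ∑' r : ℤ, h (x + r) := by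
  have hm : ∀ r : ℤ, AEStronglyMeasurable (fun x : ℝ => h (x + r))
      (volume.restrict (Set.Ioc 0 1)) := fun r =>
    (aemeasurable_comp_add hh.1.aemeasurable r).aestronglyMeasurable.restrict
  have hfin : ∫⁻ x in Set.Ioc (0 : ℝ) 1, ∑' r : ℤ, ‖h (x + r)‖ₑ ≠ ∞ := by
    rw [← lintegral_eq_lintegral_periodization (h := fun x => ‖h x‖ₑ) hh.1.enorm]
    exact hh.2.ne
  rw [(integrable_tsum_of_lintegral hm hfin).2, ← setIntegral_univ, ← iUnion_Ioc_intCast ℝ,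
    ← (hasSum_integral_iUnion (fun _ => measurableSet_Ioc) pairwise_disjoint_Ioc_int
      hh.integrableOn).tsum_eq]
  refine tsum_congr fun r => ?_
  rw [← (measurePreserving_add_right (volume : Measure ℝ) (r : ℝ)).setIntegral_preimage_emb
    (measurableEmbedding_addRight _), preimage_add_Ioc_int]

theorem ae_add_intCast {p : ℝ → Prop} (h : ∀ᵐ x, p x) : ∀ᵐ x : ℝ, ∀ r : ℤ, p (x + r) :=
  ae_all_iff.2 fun r => (measurePreserving_add_right volume (r : ℝ)).quasiMeasurePreserving.ae h

theorem volume_addCircle_one :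
    (volume : Measure (AddCircle (1 : ℝ))) = AddCircle.haarAddCircle := by
  simp [AddCircle.volume_eq_smul_haarAddCircle]

theorem ae_of_ae_addCircle {p : AddCircle (1 : ℝ) → Prop}
    (h : ∀ᵐ x ∂AddCircle.haarAddCircle, p x) : ∀ᵐ x : ℝ, p x := by
  rw [← volume_addCircle_one] at h
  rw [← Measure.restrict_univ (μ := volume), ← iUnion_Ioc_intCast ℝ, ae_restrict_iUnion_iff]
  exact fun r => (AddCircle.measurePreserving_mk 1 (r : ℝ)).quasiMeasurePreserving.ae h

/-- The characters are 1-periodic, so periodizing the integral over the line produces `G φ k l` on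
`(0,1]`. -/
theorem inner_translate_eq_zero_of_conditionC {n : ℕ} {φ : Heis n → ℂ} (hφ : MemLp φ 2 volume)
    (hC : ConditionC φ) {k l : Fin n → ℤ} (hkl : (k, l) ≠ (0, 0)) (m : ℤ) :
    inner ℂ (translateLp (latticePt k l m) φ hφ) (hφ.toLp φ) = 0 := by
  have hint : Integrable fun lam => conj (chr m lam) * crossDensity φ k l lam := by
    refine (integrable_crossDensity hφ k l).bdd_mul (c := 1)
      (Continuous.aestronglyMeasurable ?_) (ae_of_all _ fun lam => ?_)
    · exact Complex.continuous_conj.comp (continuous_chr m)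
    · rw [RCLike.norm_conj, norm_chr]
  rw [← integral_crossDensity hφ, integral_eq_integral_periodization hint]
  refine integral_eq_zero_of_ae ?_
  filter_upwards [hC k l hkl] with lam hlam
  simp only [chr_add_intCast, tsum_mul_left]
  change _ * G φ k l lam = 0
  rw [hlam, mul_zero]

/-! ### The spectral density of the central translates -/

theorem hsInner_self {n : ℕ} (T : L2R n → L2R n) : hsInner T T = ((hsNormSq T).toReal : ℂ) := by
  rw [hsNormSq, ENNReal.tsum_toReal_eq fun i => (ENNReal.pow_lt_top enorm_lt_top).ne,
    Complex.ofReal_tsum]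
  refine tsum_congr fun i => ?_
  rw [inner_self_eq_norm_sq_to_K]
  simp

/-- The weight `‖φ̂(λ)‖² |λ|ⁿ`. -/
def spectralWeight {n : ℕ} (φ : Heis n → ℂ) (lam : ℝ) : ℝ≥0∞ :=
  hsNormSq (fourierL2 φ lam) * ENNReal.ofReal (|lam| ^ n)

theorem crossDensity_zero_zero {n : ℕ} (φ : Heis n → ℂ) (lam : ℝ) :
    crossDensity φ 0 0 lam = ((spectralWeight φ lam).toReal : ℂ) := by
  have h0 : latticePt (n := n) 0 0 0 = 0 := by
    rw [latticePt_zero_zero]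
    simp
  rw [crossDensity, h0, leftTranslate_zero, hsInner_self, spectralWeight, ENNReal.toReal_mul,
    ENNReal.toReal_ofReal (by positivity)]
  push_cast
  rfl

theorem aemeasurable_spectralWeight {n : ℕ} {φ : Heis n → ℂ} (hφ : MemLp φ 2 volume) :
    AEMeasurable (spectralWeight φ) :=
  (AEMeasurable.tsum fun i =>
    ((isFourierL2_fourierL2 hφ).1 (basisL2 n i)).enorm.pow_const 2).mul
    (measurable_weight n).aemeasurable

/-- `W` is the periodization of `‖φ̂(λ)‖²|λ|ⁿ`; equivalently, `W dx` is the image of the measure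
with that density under `ℝ → ℝ/ℤ`. -/
theorem exists_spectralDensity {n : ℕ} {φ : Heis n → ℂ} (hφ : MemLp φ 2 volume) :
    ∃ W : AddCircle (1 : ℝ) → ℝ≥0∞, Measurable W ∧ ∫⁻ x, W x ∂AddCircle.haarAddCircle ≠ ∞ ∧
      (∀ m : ℤ, ∫ x, conj (fourier m x) ∂(AddCircle.haarAddCircle.withDensity W) =
        inner ℂ (translateLp (latticePt 0 0 m) φ hφ) (hφ.toLp φ)) ∧
      ∀ᵐ lam : ℝ, (G φ 0 0 lam).re = (W lam).toReal := by
  have hwm := aemeasurable_spectralWeight hφ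
  have hwfin : ∫⁻ lam, spectralWeight φ lam ≠ ∞ := (isFourierL2_fourierL2 hφ).2.1.ne
  -- The weight is only a.e. measurable; a measurable version makes the periodization measurable
  -- everywhere.
  let w := hwm.mk
  have hw : Measurable w := hwm.measurable_mk
  have hww : spectralWeight φ =ᵐ[volume] w := hwm.ae_eq_mk
  have hwlt : ∀ᵐ lam, w lam < ∞ := by
    filter_upwards [hww, ae_lt_top' hwm hwfin] with lam h1 h2
    rwa [← h1]
  let V : ℝ → ℝ≥0∞ := fun lam => ∑' r : ℤ, w (lam + r)
  have hV : Measurable V := Measurable.tsum fun r => hw.comp (by fun_prop)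
  have hVp : ∀ (lam : ℝ) (r : ℤ), V (lam + r) = V lam := by
    intro lam r
    refine Eq.trans (tsum_congr fun s => ?_) ((Equiv.addLeft r).tsum_eq (fun s : ℤ => w (lam + s)))
    simp only [Equiv.coe_addLeft]
    push_cast
    rw [add_assoc]
  -- Evaluation at the representative in `(0,1]`; periodicity of `V` makes the value independent of
  -- that choice.
  let W : AddCircle (1 : ℝ) → ℝ≥0∞ := fun x => V (AddCircle.measurableEquivIoc 1 0 x : ℝ)
  have hW : Measurable W :=
    hV.comp (measurable_subtype_coe.comp (AddCircle.measurableEquivIoc 1 0).measurable)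
  have hWV : ∀ lam : ℝ, W lam = V lam := by
    intro lam
    have h1 : (((AddCircle.measurableEquivIoc (1 : ℝ) 0 (lam : AddCircle (1 : ℝ)) : ℝ)) :
        AddCircle (1 : ℝ)) = lam := (AddCircle.equivIoc (1 : ℝ) 0).symm_apply_apply _
    rw [QuotientAddGroup.eq, AddSubgroup.mem_zmultiples_iff] at h1
    obtain ⟨r, hr⟩ := h1
    have h2 : lam = (AddCircle.measurableEquivIoc (1 : ℝ) 0 (lam : AddCircle (1 : ℝ)) : ℝ) + r := by
      simp only [zsmul_eq_mul, mul_one] at hr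
      linarith
    conv_rhs => rw [h2]
    rw [hVp]
  have hmk : Measurable ((↑) : ℝ → AddCircle (1 : ℝ)) := AddCircle.measurable_mk'
  have hlint : ∀ q : AddCircle (1 : ℝ) → ℝ≥0∞, Measurable q →
      ∫⁻ lam : ℝ, w lam * q lam = ∫⁻ x, W x * q x ∂AddCircle.haarAddCircle := by
    intro q hq
    rw [lintegral_eq_lintegral_periodization (h := fun lam => w lam * q lam)
      (hw.mul (hq.comp hmk)).aemeasurable,
      ← volume_addCircle_one, ← AddCircle.lintegral_preimage 1 0, zero_add]
    refine lintegral_congr fun lam => ?_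
    have e : ∀ r : ℤ, ((lam + r : ℝ) : AddCircle (1 : ℝ)) = lam := fun r => by
      rw [QuotientAddGroup.eq]
      exact AddSubgroup.mem_zmultiples_iff.2 ⟨-r, by simp⟩
    simp only [e, ENNReal.tsum_mul_right, hWV, V]
  have hmap : AddCircle.haarAddCircle.withDensity W =
      (volume.withDensity w).map ((↑) : ℝ → AddCircle (1 : ℝ)) := by
    ext s hs
    rw [withDensity_apply _ hs, Measure.map_apply hmk hs, withDensity_apply _ (hmk hs),
      ← lintegral_indicator hs, ← lintegral_indicator (hmk hs)]
    have h := hlint (s.indicator 1) (measurable_one.indicator hs)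
    refine Eq.trans (lintegral_congr fun x => ?_) (h.symm.trans (lintegral_congr fun x => ?_))
    · by_cases hx : x ∈ s <;> simp [hx]
    · by_cases hx : (x : AddCircle (1 : ℝ)) ∈ s <;> simp [hx]
  refine ⟨W, hW, ?_, fun m => ?_, ?_⟩
  · have h := hlint 1 measurable_one
    simp only [Pi.one_apply, mul_one] at h
    rw [← h, ← lintegral_congr_ae hww]
    exact hwfin
  · have hc : Continuous fun x : AddCircle (1 : ℝ) => conj (fourier m x) :=
      Complex.continuous_conj.comp (fourier m).continuous
    rw [hmap, integral_map hmk.aemeasurable hc.aestronglyMeasurable,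
      integral_withDensity_eq_integral_toReal_smul hw hwlt, ← integral_crossDensity hφ]
    refine integral_congr_ae ?_
    filter_upwards [hww] with lam h
    rw [crossDensity_zero_zero, h, chr_eq_fourier, Complex.real_smul, mul_comm]
  · filter_upwards [ae_add_intCast hww, ae_add_intCast hwlt] with lam h1 h2
    have h3 : G φ 0 0 lam = ∑' r : ℤ, crossDensity φ 0 0 (lam + r) := rfl
    rw [h3, hWV]
    simp only [crossDensity_zero_zero, h1, V]
    rw [← Complex.ofReal_tsum, Complex.ofReal_re, ENNReal.tsum_toReal_eq fun r => (h2 r).ne]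

/-! ### Inner products of lattice translates -/

theorem zero_hmul {n : ℕ} (p : Heis n) : hmul 0 p = p := by
  refine Prod.ext ?_ (Prod.ext ?_ ?_) <;> simp [hmul]

theorem measurableEmbedding_hmul {n : ℕ} (p : Heis n) : MeasurableEmbedding (hmul p) := by
  refine (measurePreserving_hmul p).measurable.measurableEmbedding fun a b hab => ?_
  have h := congrArg (hmul (hinv p)) hab
  simpa only [← hmul_assoc, hinv_hmul, zero_hmul] using h

/-- Left invariance of the measure, through the substitution `X ↦ qX`. -/
theorem inner_translateLp {n : ℕ} {f g : Heis n → ℂ} (hf : MemLp f 2 volume)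
    (hg : MemLp g 2 volume) (p q : Heis n) :
    inner ℂ (translateLp p f hf) (translateLp q g hg) =
      inner ℂ (translateLp (hmul (hinv q) p) f hf) (hg.toLp g) := by
  have h1 : inner ℂ (translateLp p f hf) (translateLp q g hg) =
      ∫ X, inner ℂ (leftTranslate p f X) (leftTranslate q g X) := by
    rw [L2.inner_def]
    refine integral_congr_ae ?_
    filter_upwards [(memLp_leftTranslate p hf).coeFn_toLp, (memLp_leftTranslate q hg).coeFn_toLp]
      with X h2 h3
    rw [translateLp, translateLp, h2, h3]
  have h2 : inner ℂ (translateLp (hmul (hinv q) p) f hf) (hg.toLp g) =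
      ∫ X, inner ℂ (leftTranslate (hmul (hinv q) p) f X) (g X) := by
    rw [L2.inner_def]
    refine integral_congr_ae ?_
    filter_upwards [(memLp_leftTranslate (hmul (hinv q) p) hf).coeFn_toLp, hg.coeFn_toLp]
      with X h2 h3
    rw [translateLp, h2, h3]
  rw [h1, h2, ← (measurePreserving_hmul q).integral_comp (measurableEmbedding_hmul q)]
  refine integral_congr_ae (ae_of_all _ fun X => ?_)
  have e1 : leftTranslate q g (hmul q X) = g X := by
    rw [leftTranslate, ← hmul_assoc, hinv_hmul, zero_hmul]
  have e2 : leftTranslate p f (hmul q X) = leftTranslate (hmul (hinv q) p) f X := by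
    rw [← leftTranslate_leftTranslate]
    simp only [leftTranslate]
    congr 3
    simp [hinv]
  simp only [e1, e2]

/-- The factor `2` in `2k` cancels the `½` of the group law, so the central component stays an
integer. -/
theorem hmul_hinv_latticePt {n : ℕ} (k l k' l' : Fin n → ℤ) (m m' : ℤ) :
    hmul (hinv (latticePt k l m)) (latticePt k' l' m') =
      latticePt (k' - k) (l' - l) (m' - m + ∑ i, (k i * l' i - k' i * l i)) := by
  refine Prod.ext ?_ (Prod.ext ?_ ?_)
  · ext i
    simp [hmul, hinv, latticePt]
    ring
  · ext i
    simp [hmul, hinv, latticePt]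
    ring
  · simp only [hmul, hinv, latticePt, inner_neg_right, PiLp.inner_apply, RCLike.inner_apply,
      conj_trivial]
    push_cast
    rw [sub_neg_eq_add, ← Finset.sum_neg_distrib, ← Finset.sum_add_distrib, Finset.mul_sum]
    have : ∑ i, (1 / 2 : ℝ) * (-((l i : ℝ) * (2 * (k' i : ℝ))) + 2 * (k i : ℝ) * (l' i : ℝ)) =
        ∑ i, ((k i : ℝ) * l' i - k' i * l i) := Finset.sum_congr rfl fun i _ => by ring
    rw [this]
    ring

theorem translateLp_lattice_zero {n : ℕ} {φ : Heis n → ℂ} (hφ : MemLp φ 2 volume) :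
    translateLp (latticePt 0 0 0) φ hφ = hφ.toLp φ := by
  have h0 : latticePt (n := n) 0 0 0 = 0 := by
    rw [latticePt_zero_zero]
    simp
  refine MemLp.toLp_congr _ _ (ae_of_all _ fun X => ?_)
  rw [h0, leftTranslate_zero]

theorem inner_translateLp_lattice_eq_zero {n : ℕ} {φ : Heis n → ℂ} (hφ : MemLp φ 2 volume)
    (hC : ConditionC φ) {k l k' l' : Fin n → ℤ} (h : (k, l) ≠ (k', l')) (m m' : ℤ) :
    inner ℂ (translateLp (latticePt k l m) φ hφ) (translateLp (latticePt k' l' m') φ hφ) = 0 := by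
  rw [inner_translateLp, hmul_hinv_latticePt]
  refine inner_translate_eq_zero_of_conditionC hφ hC (fun h0 => h ?_) _
  rw [Prod.mk.injEq] at h0 ⊢
  exact ⟨sub_eq_zero.1 h0.1, sub_eq_zero.1 h0.2⟩

/-- For equal `(k,l)` the symplectic term vanishes, so the Gram matrix in `m` does not depend on
`(k,l)`: one density serves all the cyclic spaces. -/
theorem inner_translateLp_lattice_same {n : ℕ} {φ : Heis n → ℂ} (hφ : MemLp φ 2 volume)
    (k l : Fin n → ℤ) (m m' : ℤ) :
    inner ℂ (translateLp (latticePt k l m) φ hφ) (translateLp (latticePt k l m') φ hφ) =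
      inner ℂ (translateLp (latticePt 0 0 (m - m')) φ hφ) (hφ.toLp φ) := by
  rw [inner_translateLp, hmul_hinv_latticePt, sub_self, sub_self]
  have : ∑ i, (k i * l i - k i * l i) = 0 := by simp
  rw [this, add_zero]

/-! ### Isometries given by equal Gram matrices -/

theorem inner_linearCombination {H ι : Type*} [NormedAddCommGroup H] [InnerProductSpace ℂ H]
    (v : ι → H) (c : ι →₀ ℂ) :
    inner ℂ (Finsupp.linearCombination ℂ v c) (Finsupp.linearCombination ℂ v c) =
      ∑ i ∈ c.support, ∑ j ∈ c.support, conj (c i) * (c j * inner ℂ (v i) (v j)) := by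
  rw [Finsupp.linearCombination_apply, Finsupp.sum, sum_inner]
  refine Finset.sum_congr rfl fun i _ => ?_
  rw [inner_smul_left, inner_sum, Finset.mul_sum]
  simp only [inner_smul_right]

/-- Equal Gram matrices give equal norms of finite linear combinations; the correspondence extends
by density. -/
theorem exists_linearIsometry_of_gram {K H ι : Type*} [NormedAddCommGroup K]
    [InnerProductSpace ℂ K] [NormedAddCommGroup H] [InnerProductSpace ℂ H] [CompleteSpace H]
    {e : ι → K} {v : ι → H} (he : (Submodule.span ℂ (Set.range e)).topologicalClosure = ⊤)
    (h : ∀ i j, inner ℂ (v i) (v j) = inner ℂ (e i) (e j)) :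
    ∃ J : K →ₗᵢ[ℂ] H, ∀ i, J (e i) = v i := by
  have hd : DenseRange (Finsupp.linearCombination ℂ e) := by
    rw [DenseRange, ← LinearMap.coe_range, Finsupp.range_linearCombination]
    exact Submodule.dense_iff_topologicalClosure_eq_top.2 he
  have hn : ∀ c, ‖Finsupp.linearCombination ℂ v c‖ = ‖Finsupp.linearCombination ℂ e c‖ := by
    intro c
    rw [@norm_eq_sqrt_re_inner ℂ, @norm_eq_sqrt_re_inner ℂ, inner_linearCombination,
      inner_linearCombination]
    simp only [h]
  refine ⟨⟨((Finsupp.linearCombination ℂ v).extendOfNorm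
    (Finsupp.linearCombination ℂ e)).toLinearMap, norm_extendOfNorm_eq hd hn⟩, fun i => ?_⟩
  have h1 := LinearMap.extendOfNorm_eq (f := Finsupp.linearCombination ℂ v) hd
    ⟨1, fun x => by rw [one_mul, hn]⟩ (Finsupp.single i 1)
  simpa using h1

/-- The character `fourier m` as an element of `L²(ν)`. -/
def charLp (ν : Measure (AddCircle (1 : ℝ))) [IsFiniteMeasure ν] (m : ℤ) : Lp ℂ 2 ν :=
  ContinuousMap.toLp (E := ℂ) 2 ν ℂ (fourier m)

/-! ### Characters in `L²` of a finite measure on the circle -/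

section charLp

variable (ν : Measure (AddCircle (1 : ℝ))) [IsFiniteMeasure ν]

theorem coeFn_charLp (m : ℤ) : charLp ν m =ᵐ[ν] fourier m := ContinuousMap.coeFn_toLp ν (fourier m)

/-- Trigonometric polynomials are uniformly dense in the continuous functions, which are dense in
`L²(ν)` for every finite `ν`. -/
theorem span_charLp_closure_eq_top :
    (Submodule.span ℂ (Set.range (charLp ν))).topologicalClosure = ⊤ := by
  convert! (ContinuousMap.toLp_denseRange ℂ ν ℂ (p := 2)
    (by norm_num)).topologicalClosure_map_submodule span_fourier_closure_eq_top
  rw [Submodule.map_span]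
  unfold charLp
  rw [Set.range_comp']
  simp only [ContinuousLinearMap.coe_coe]

theorem inner_charLp_left (m : ℤ) (q : Lp ℂ 2 ν) :
    inner ℂ (charLp ν m) q = ∫ x, conj (fourier m x) * q x ∂ν := by
  rw [L2.inner_def]
  refine integral_congr_ae ?_
  filter_upwards [coeFn_charLp ν m] with x hx
  rw [hx, RCLike.inner_apply']

theorem inner_charLp (a b : ℤ) :
    inner ℂ (charLp ν a) (charLp ν b) = ∫ x, conj (fourier (a - b) x) ∂ν := by
  rw [inner_charLp_left]
  refine integral_congr_ae ?_
  filter_upwards [coeFn_charLp ν b] with x hx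
  rw [hx, ← fourier_neg, ← fourier_neg, ← fourier_add]
  congr 1
  ring_nf

end charLp

/-- `W` is the density of a finite measure on the circle whose Fourier coefficients are the inner
products of `φ` with its central translates. -/
structure IsSpectralDensity {n : ℕ} (φ : Heis n → ℂ) (hφ : MemLp φ 2 volume)
    (W : AddCircle (1 : ℝ) → ℝ≥0∞) : Prop where
  measurable : Measurable W
  lintegral_ne_top : ∫⁻ x, W x ∂AddCircle.haarAddCircle ≠ ∞
  integral_conj_fourier : ∀ m : ℤ,
    ∫ x, conj (fourier m x) ∂(AddCircle.haarAddCircle.withDensity W) =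
      inner ℂ (translateLp (latticePt 0 0 m) φ hφ) (hφ.toLp φ)

/-- The measure on the circle with density `W`. -/
abbrev densityMeasure (W : AddCircle (1 : ℝ) → ℝ≥0∞) : Measure (AddCircle (1 : ℝ)) :=
  AddCircle.haarAddCircle.withDensity W

/-! ### Spectral models of the cyclic spaces and frame bounds -/

section SpectralDensity

variable {n : ℕ} {φ : Heis n → ℂ} {hφ : MemLp φ 2 volume} {W : AddCircle (1 : ℝ) → ℝ≥0∞}

theorem IsSpectralDensity.isFiniteMeasure (hW : IsSpectralDensity φ hφ W) :
    IsFiniteMeasure (densityMeasure W) :=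
  isFiniteMeasure_withDensity hW.lintegral_ne_top

/-- The model of the cyclic space of index `(k,l)`: multiplication by characters on `L²(W dx)`
replaces central translation. -/
theorem IsSpectralDensity.exists_isometry (hW : IsSpectralDensity φ hφ W)
    [IsFiniteMeasure (densityMeasure W)] (k l : Fin n → ℤ) :
    ∃ J : Lp ℂ 2 (densityMeasure W) →ₗᵢ[ℂ] Lp ℂ 2 (volume : Measure (Heis n)),
      ∀ m, J (charLp _ m) = translateLp (latticePt k l m) φ hφ := by
  refine exists_linearIsometry_of_gram (span_charLp_closure_eq_top _) fun a b => ?_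
  rw [inner_translateLp_lattice_same, inner_charLp, hW.integral_conj_fourier]

theorem map_mem_of_charLp {ν : Measure (AddCircle (1 : ℝ))} [IsFiniteMeasure ν] {H : Type*}
    [NormedAddCommGroup H] [InnerProductSpace ℂ H] (J : Lp ℂ 2 ν →ₗᵢ[ℂ] H) {V : Submodule ℂ H}
    (hV : IsClosed (V : Set H)) (h : ∀ m, J (charLp ν m) ∈ V) (q : Lp ℂ 2 ν) : J q ∈ V := by
  have h1 : Submodule.span ℂ (Set.range (charLp ν)) ≤ V.comap J.toLinearMap := by
    rw [Submodule.span_le]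
    rintro _ ⟨m, rfl⟩
    exact h m
  have h2 : IsClosed (V.comap J.toLinearMap : Set (Lp ℂ 2 ν)) := hV.preimage J.continuous
  have h3 := Submodule.topologicalClosure_minimal _ h1 h2
  rw [span_charLp_closure_eq_top] at h3
  exact h3 Submodule.mem_top

theorem inner_isometry_eq_zero {ν ν' : Measure (AddCircle (1 : ℝ))} [IsFiniteMeasure ν]
    [IsFiniteMeasure ν'] {H : Type*} [NormedAddCommGroup H] [InnerProductSpace ℂ H]
    [CompleteSpace H] (J : Lp ℂ 2 ν →ₗᵢ[ℂ] H) (J' : Lp ℂ 2 ν' →ₗᵢ[ℂ] H)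
    (h : ∀ m m', inner ℂ (J (charLp ν m)) (J' (charLp ν' m')) = 0) (q : Lp ℂ 2 ν)
    (q' : Lp ℂ 2 ν') : inner ℂ (J q) (J' q') = 0 := by
  have h1 : ∀ m, J' q' ∈ (Submodule.span ℂ {J (charLp ν m)})ᗮ := fun m =>
    map_mem_of_charLp J' (Submodule.isClosed_orthogonal _)
      (fun m' => Submodule.mem_orthogonal_singleton_iff_inner_right.2 (h m m')) q'
  have h2 : J q ∈ (Submodule.span ℂ {J' q'})ᗮ :=
    map_mem_of_charLp J (Submodule.isClosed_orthogonal _)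
      (fun m => Submodule.mem_orthogonal_singleton_iff_inner_left.2
        (Submodule.mem_orthogonal_singleton_iff_inner_right.1 (h1 m))) q
  exact Submodule.mem_orthogonal_singleton_iff_inner_left.1 h2

theorem tsum_enorm_sq_fourierCoeff {h : AddCircle (1 : ℝ) → ℂ}
    (hh : MemLp h 2 AddCircle.haarAddCircle) :
    ∑' m : ℤ, ‖∫ x, conj (fourier m x) * h x ∂AddCircle.haarAddCircle‖ₑ ^ 2 =
      ∫⁻ x, ‖h x‖ₑ ^ 2 ∂AddCircle.haarAddCircle := by
  have h1 := hasSum_norm_sq_inner fourierBasis (hh.toLp h)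
  have h2 := lintegral_enorm_sq_toLp (hh.toLp h)
  rw [← h2] at h1
  have h3 : ∫⁻ x, ‖hh.toLp h x‖ₑ ^ 2 ∂AddCircle.haarAddCircle =
      ∫⁻ x, ‖h x‖ₑ ^ 2 ∂AddCircle.haarAddCircle := by
    refine lintegral_congr_ae ?_
    filter_upwards [hh.coeFn_toLp] with x hx
    rw [hx]
  rw [← h3, ← h1]
  refine tsum_congr fun m => ?_
  congr 1
  refine enorm_eq_iff_norm_eq.2 ?_
  rw [norm_inner_symm, coe_fourierBasis, L2.inner_def]
  congr 1
  refine integral_congr_ae ?_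
  filter_upwards [hh.coeFn_toLp, coeFn_fourierLp 2 m] with x hx h3
  rw [hx, h3, RCLike.inner_apply']

/-- On a set where the density is bounded, the frame coefficients of the indicator function are
given by Parseval's identity. -/
theorem frame_indicator (hW : Measurable W) [IsFiniteMeasure (densityMeasure W)]
    {S : Set (AddCircle (1 : ℝ))} (hS : MeasurableSet S) {R : ℝ≥0∞} (hR : R ≠ ∞)
    (hSR : ∀ x ∈ S, W x ≤ R) :
    ∃ q : Lp ℂ 2 (densityMeasure W),
      ‖q‖ₑ ^ 2 = ∫⁻ x in S, W x ∂AddCircle.haarAddCircle ∧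
      ∑' m, ‖inner ℂ (charLp _ m) q‖ₑ ^ 2 = ∫⁻ x in S, W x ^ 2 ∂AddCircle.haarAddCircle := by
  classical
  have hq : MemLp (S.indicator fun _ => (1 : ℂ)) 2 (densityMeasure W) :=
    (memLp_const 1).indicator hS
  have hW' : Measurable (S.indicator W) := hW.indicator hS
  have hWR : ∀ x, S.indicator W x ≤ R := fun x => by
    by_cases hx : x ∈ S <;> simp [hx, hSR]
  have hWt : ∀ x, S.indicator W x ≠ ∞ := fun x => ((hWR x).trans_lt hR.lt_top).ne
  have hν : (densityMeasure W).restrict S = AddCircle.haarAddCircle.withDensity (S.indicator W) := by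
    rw [restrict_withDensity hS, withDensity_indicator hS]
  refine ⟨hq.toLp _, ?_, ?_⟩
  · rw [← lintegral_enorm_sq_toLp, lintegral_congr_ae (g := S.indicator fun _ => 1),
      lintegral_indicator_const hS, one_mul, withDensity_apply _ hS]
    filter_upwards [hq.coeFn_toLp] with x hx
    rw [hx]
    by_cases hx : x ∈ S <;> simp [hx]
  · have e : ∀ m : ℤ, inner ℂ (charLp _ m) (hq.toLp _) =
        ∫ x, conj (fourier m x) * ((S.indicator W x).toReal : ℂ) ∂AddCircle.haarAddCircle := by
      intro m
      rw [inner_charLp_left]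
      have e1 : ∫ x, conj (fourier m x) * hq.toLp _ x ∂densityMeasure W =
          ∫ x, S.indicator (fun x => conj (fourier m x)) x ∂densityMeasure W := by
        refine integral_congr_ae ?_
        filter_upwards [hq.coeFn_toLp] with x hx
        rw [hx]
        by_cases hx : x ∈ S <;> simp [hx]
      rw [e1, integral_indicator hS, hν, integral_withDensity_eq_integral_toReal_smul hW'
        (ae_of_all _ fun x => (hWt x).lt_top)]
      refine integral_congr_ae (ae_of_all _ fun x => ?_)
      simp only [Complex.real_smul, mul_comm]
    -- The inner products are Fourier coefficients of `1_S W` for Haar measure; boundedness of `W`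
    -- on `S` puts this function in `L²`.
    have hh : MemLp (fun x => ((S.indicator W x).toReal : ℂ)) 2 AddCircle.haarAddCircle := by
      refine MemLp.of_bound (Complex.measurable_ofReal.comp
        hW'.ennreal_toReal).aestronglyMeasurable R.toReal (ae_of_all _ fun x => ?_)
      rw [Complex.norm_real, Real.norm_of_nonneg ENNReal.toReal_nonneg]
      exact ENNReal.toReal_mono hR (hWR x)
    simp only [e]
    rw [tsum_enorm_sq_fourierCoeff hh, ← lintegral_indicator hS]
    refine lintegral_congr fun x => ?_
    have e2 : ‖((S.indicator W x).toReal : ℂ)‖ₑ = S.indicator W x := by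
      rw [← ofReal_norm, Complex.norm_real, Real.norm_of_nonneg ENNReal.toReal_nonneg,
        ENNReal.ofReal_toReal (hWt x)]
    rw [e2]
    by_cases hx : x ∈ S <;> simp [hx]

/-- A strict pointwise inequality on `S` contradicted by the integrals forces `S` to be null. -/
theorem ae_notMem_of_lintegral {α : Type*} [MeasurableSpace α] {μ : Measure α} {S : Set α}
    (hS : MeasurableSet S) {f g : α → ℝ≥0∞} (hg : Measurable g) (hfg : ∀ x ∈ S, f x < g x)
    (hfin : ∫⁻ x in S, f x ∂μ ≠ ∞) (h : ∫⁻ x in S, g x ∂μ ≤ ∫⁻ x in S, f x ∂μ) :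
    ∀ᵐ x ∂μ, x ∉ S := by
  have h1 := ae_eq_of_ae_le_of_lintegral_le
    ((ae_restrict_iff' hS).2 (ae_of_all _ fun x hx => (hfg x hx).le)) hfin hg.aemeasurable h
  filter_upwards [(ae_restrict_iff' hS).1 h1] with x hx hxS
  exact (hfg x hxS).ne (hx hxS)

/-- The frame inequalities bound the spectral density from above and below on its support. -/
theorem IsSpectralDensity.frame_bounds (hW : IsSpectralDensity φ hφ W)
    {V₀ : Submodule ℂ (Lp ℂ 2 (volume : Measure (Heis n)))}
    (hV₀ : IsClosed (V₀ : Set (Lp ℂ 2 (volume : Measure (Heis n))))) (hC : ConditionC φ)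
    (hframe : IsFrameFor V₀ fun i : (Fin n → ℤ) × (Fin n → ℤ) × ℤ =>
      translateLp (latticePt i.1 i.2.1 i.2.2) φ hφ) :
    ∃ A B : ℝ, 0 < A ∧ 0 < B ∧ ∀ᵐ x ∂AddCircle.haarAddCircle,
      W x ≤ ENNReal.ofReal B ∧ (W x ≠ 0 → ENNReal.ofReal A ≤ W x) := by
  have := hW.isFiniteMeasure
  obtain ⟨hmem, A, B, hA, hB, hAB⟩ := hframe
  obtain ⟨J, hJ⟩ := hW.exists_isometry 0 0
  -- Inside the cyclic space of index `(0,0)` the frame inequalities involve only the characters.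
  have hfr : ∀ q : Lp ℂ 2 (densityMeasure W), ENNReal.ofReal A * ‖q‖ₑ ^ 2 ≤ ∑' m, ‖inner ℂ (charLp _ m) q‖ₑ ^ 2 ∧
      ∑' m, ‖inner ℂ (charLp _ m) q‖ₑ ^ 2 ≤ ENNReal.ofReal B * ‖q‖ₑ ^ 2 := by
    intro q
    have h1 := hAB (J q) (map_mem_of_charLp J hV₀ (fun m => by
      rw [hJ]
      exact hmem (0, 0, m)) q)
    have hsum : ∑' i : (Fin n → ℤ) × (Fin n → ℤ) × ℤ,
        ‖inner ℂ (translateLp (latticePt i.1 i.2.1 i.2.2) φ hφ) (J q)‖ₑ ^ 2 =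
        ∑' m, ‖inner ℂ (charLp _ m) q‖ₑ ^ 2 := by
      have hinj : Function.Injective fun m : ℤ => ((0, 0, m) : (Fin n → ℤ) × (Fin n → ℤ) × ℤ) :=
        fun a b hab => by simpa using hab
      rw [← hinj.tsum_eq]
      · refine tsum_congr fun m => ?_
        simp only
        rw [← hJ, J.inner_map_map]
      -- Terms with `(k,l) ≠ (0,0)` vanish by Condition C.
      · rintro ⟨k, l, m⟩ hi
        by_contra hne
        refine hi ?_
        obtain ⟨J', hJ'⟩ := hW.exists_isometry k l
        have hkl : (k, l) ≠ (0, 0) := by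
          rintro h0
          rw [Prod.mk.injEq] at h0
          exact hne ⟨m, by rw [h0.1, h0.2]⟩
        have h0 := inner_isometry_eq_zero J' J (fun a b => by
          rw [hJ', hJ]
          exact inner_translateLp_lattice_eq_zero hφ hC hkl a b) (charLp _ m) q
        rw [hJ'] at h0
        simp [h0]
    have e : ∀ c : ℝ, 0 < c → ENNReal.ofReal (c * ‖J q‖ ^ 2) = ENNReal.ofReal c * ‖q‖ₑ ^ 2 := by
      intro c hc
      rw [J.norm_map, ENNReal.ofReal_mul hc.le, ENNReal.ofReal_pow (norm_nonneg _), ofReal_norm]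
    rwa [hsum, e A hA, e B hB] at h1
  refine ⟨A, B, hA, hB, ?_⟩
  have hfin : ∀ S : Set (AddCircle (1 : ℝ)), ∀ c : ℝ,
      ∫⁻ x in S, ENNReal.ofReal c * W x ∂AddCircle.haarAddCircle ≠ ∞ := by
    intro S c
    rw [lintegral_const_mul _ hW.measurable]
    exact ENNReal.mul_ne_top ENNReal.ofReal_ne_top
      ((setLIntegral_le_lintegral _ _).trans_lt hW.lintegral_ne_top.lt_top).ne
  have hlt : ∀ᵐ x ∂AddCircle.haarAddCircle, W x < ∞ := ae_lt_top hW.measurable hW.lintegral_ne_top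
  -- On `S = {B < W ≤ R}` the upper frame bound for `1_S` reads `∫_S W² ≤ B ∫_S W`, although `W² > B
  -- W` there. The cutoff `R` keeps `W` bounded and the integrals finite.
  have hup : ∀ R : ℕ, ∀ᵐ x ∂AddCircle.haarAddCircle,
      x ∉ {x | ENNReal.ofReal B < W x ∧ W x ≤ R} := by
    intro R
    have hS : MeasurableSet {x | ENNReal.ofReal B < W x ∧ W x ≤ R} :=
      (measurableSet_lt measurable_const hW.measurable).inter
        (measurableSet_le hW.measurable measurable_const)
    refine ae_notMem_of_lintegral hS (f := fun x => ENNReal.ofReal B * W x) (g := fun x => W x ^ 2)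
      (hW.measurable.pow_const 2) ?_ (hfin _ B) ?_
    · rintro x ⟨h1, h2⟩
      rw [pow_two]
      exact ENNReal.mul_lt_mul_left (pos_of_gt h1).ne' (h2.trans_lt (by simp)).ne h1
    · obtain ⟨q, hq1, hq2⟩ := frame_indicator hW.measurable hS (R := R) (by simp) fun x hx => hx.2
      rw [lintegral_const_mul _ hW.measurable, ← hq1, ← hq2]
      exact (hfr q).2
  -- On `S = {0 < W < A}` the lower frame bound reads `A ∫_S W ≤ ∫_S W²`, although `W² < A W` there;
  -- no cutoff is needed.
  have hlow : ∀ᵐ x ∂AddCircle.haarAddCircle, x ∉ {x | W x ≠ 0 ∧ W x < ENNReal.ofReal A} := by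
    have hS : MeasurableSet {x | W x ≠ 0 ∧ W x < ENNReal.ofReal A} :=
      (hW.measurable (measurableSet_singleton 0)).compl.inter
        (measurableSet_lt hW.measurable measurable_const)
    obtain ⟨q, hq1, hq2⟩ := frame_indicator hW.measurable hS (R := ENNReal.ofReal A) (by simp)
      fun x hx => hx.2.le
    have hle : ∫⁻ x in {x | W x ≠ 0 ∧ W x < ENNReal.ofReal A}, ENNReal.ofReal A * W x
        ∂AddCircle.haarAddCircle ≤ ∫⁻ x in {x | W x ≠ 0 ∧ W x < ENNReal.ofReal A}, W x ^ 2
        ∂AddCircle.haarAddCircle := by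
      rw [lintegral_const_mul _ hW.measurable, ← hq1, ← hq2]
      exact (hfr q).1
    have hlt : ∀ x ∈ {x | W x ≠ 0 ∧ W x < ENNReal.ofReal A}, W x ^ 2 < ENNReal.ofReal A * W x := by
      rintro x ⟨h1, h2⟩
      rw [pow_two]
      exact ENNReal.mul_lt_mul_left h1 (h2.trans_le le_top).ne h2
    refine ae_notMem_of_lintegral hS (measurable_const.mul hW.measurable) hlt
      (ne_top_of_le_ne_top (hfin {x | W x ≠ 0 ∧ W x < ENNReal.ofReal A} A) ?_) hle
    exact lintegral_mono_ae ((ae_restrict_iff' hS).2 (ae_of_all _ fun x hx => (hlt x hx).le))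
  filter_upwards [ae_all_iff.2 hup, hlow, hlt] with x h1 h2 h3
  refine ⟨?_, fun h0 => ?_⟩
  · by_contra hcon
    obtain ⟨R, hR⟩ := ENNReal.exists_nat_gt h3.ne
    exact h1 R ⟨not_le.1 hcon, hR.le⟩
  · by_contra hcon
    exact h2 ⟨h0, not_le.1 hcon⟩

end SpectralDensity

/-! ### Pointwise convergence and uniform bounds -/

theorem tsum_enorm_sq_lp (b : lp (fun _ : ℤ => ℂ) 2) : ∑' m, ‖b m‖ₑ ^ 2 = ‖b‖ₑ ^ 2 := by
  have h := lp.hasSum_norm (by norm_num) b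
  simp only [ENNReal.toReal_ofNat, Real.rpow_ofNat] at h
  have h2 := ENNReal.ofReal_tsum_of_nonneg (fun m => by positivity) h.summable
  rw [h.tsum_eq, ENNReal.ofReal_pow (norm_nonneg _), ofReal_norm] at h2
  rw [h2]
  refine tsum_congr fun m => ?_
  rw [ENNReal.ofReal_pow (norm_nonneg _), ofReal_norm]

theorem memℓp_of_tsum_enorm_sq {a : ℤ → ℂ} (h : ∑' m, ‖a m‖ₑ ^ 2 ≠ ∞) : Memℓp a 2 := by
  refine memℓp_gen ?_
  simp only [ENNReal.toReal_ofNat, Real.rpow_ofNat]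
  have := ENNReal.summable_toReal h
  simpa using this

theorem tendsto_sum_single (a : ℤ → ℂ) (m : ℤ) :
    Tendsto (fun N : ℕ => ∑ j ∈ Finset.Icc (-(N : ℤ)) N, (Pi.single m 1 : ℤ → ℂ) j * a j)
      atTop (𝓝 (a m)) := by
  have h : HasSum (fun j => (Pi.single m 1 : ℤ → ℂ) j * a j) ((Pi.single m 1 : ℤ → ℂ) m * a m) :=
    hasSum_single m fun j hj => by simp [hj]
  rw [Pi.single_eq_same, one_mul] at h
  exact h.comp Finset.tendsto_Icc_neg

theorem memℓp_single (m : ℤ) : Memℓp (Pi.single m 1 : ℤ → ℂ) 2 := by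
  refine memℓp_of_tsum_enorm_sq ?_
  rw [tsum_eq_single m fun j hj => by simp [hj]]
  simp

/-- If all series `∑ c m * a m x` with `c ∈ ℓ²(ℤ)` converge for symmetric summation to functions
bounded on `K`, then `∑ ‖a m x‖²` is bounded on `K`. -/
theorem exists_tsum_enorm_sq_le {X : Type*} (a : ℤ → X → ℂ) (K : Set X)
    (h : ∀ c : ℤ → ℂ, Memℓp c 2 → ∃ s : X → ℂ, (∃ C, ∀ x ∈ K, ‖s x‖ ≤ C) ∧
      ∀ x, Tendsto (fun N : ℕ => ∑ m ∈ Finset.Icc (-(N : ℤ)) N, c m * a m x) atTop (𝓝 (s x))) :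
    ∃ C : ℝ, ∀ x ∈ K, ∑' m, ‖a m x‖ₑ ^ 2 ≤ ENNReal.ofReal C := by
  choose! s hsb hs using h
  let L : ℕ → X → lp (fun _ : ℤ => ℂ) 2 →L[ℂ] ℂ := fun N x =>
    ∑ m ∈ Finset.Icc (-(N : ℤ)) N, innerSL ℂ (lp.single 2 m (conj (a m x)) : lp (fun _ : ℤ => ℂ) 2)
  have hL : ∀ N x (c : lp (fun _ : ℤ => ℂ) 2),
      L N x c = ∑ m ∈ Finset.Icc (-(N : ℤ)) N, c m * a m x := by
    intro N x c
    simp only [L, _root_.sum_apply, innerSL_apply_apply]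
    refine Finset.sum_congr rfl fun m _ => ?_
    rw [lp.inner_single_left, RCLike.inner_apply, Complex.conj_conj]
  have hlim : ∀ x, Tendsto (fun N c => L N x c) atTop
      (𝓝 fun c : lp (fun _ : ℤ => ℂ) 2 => s c x) := fun x => by
    rw [tendsto_pi_nhds]
    intro c
    simp only [hL]
    exact hs c (lp.memℓp c) x
  -- A pointwise limit of continuous functionals on `ℓ²(ℤ)` is continuous by Banach–Steinhaus.
  let M : X → lp (fun _ : ℤ => ℂ) 2 →L[ℂ] ℂ := fun x =>
    continuousLinearMapOfTendsto (fun N => L N x) (hlim x)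
  have hM : ∀ x c, M x c = s c x := fun x c => rfl
  -- A second use of the principle, now over `x ∈ K`: each `c` gives a function bounded on `K`, so
  -- the norms of the functionals are bounded on `K`.
  obtain ⟨C, hC⟩ := banach_steinhaus (g := fun x : K => M x) fun c => by
    obtain ⟨C, hC⟩ := hsb c (lp.memℓp c)
    exact ⟨C, fun x => hC x x.2⟩
  refine ⟨C ^ 2, fun x hx => ?_⟩
  -- The Riesz representative of `M x`. Testing on unit vectors shows that its coordinates have the
  -- moduli `‖a m x‖`, so the sum to be bounded is `‖M x‖²`.
  let b := (InnerProductSpace.toDual ℂ (lp (fun _ : ℤ => ℂ) 2)).symm (M x)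
  have hb : ∀ m, ‖b m‖ₑ = ‖a m x‖ₑ := by
    intro m
    have h1 : inner ℂ b (lp.single 2 m (1 : ℂ)) = M x (lp.single 2 m (1 : ℂ)) :=
      InnerProductSpace.toDual_symm_apply
    have h2 : M x (lp.single 2 m (1 : ℂ)) = a m x :=
      tendsto_nhds_unique (hs _ (memℓp_single m) x) (tendsto_sum_single (fun m => a m x) m)
    rw [h2, lp.inner_single_right, RCLike.inner_apply, one_mul] at h1
    rw [← h1]
    exact enorm_eq_iff_norm_eq.2 (RCLike.norm_conj _).symm
  have hn : ‖b‖ ≤ C := by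
    rw [LinearIsometryEquiv.norm_map]
    exact hC ⟨x, hx⟩
  simp only [← hb]
  rw [tsum_enorm_sq_lp, ← ofReal_norm, ← ENNReal.ofReal_pow (norm_nonneg _)]
  exact ENNReal.ofReal_le_ofReal (by gcongr)

theorem leftTranslate_latticePt_zero {n : ℕ} (f : Heis n → ℂ) :
    leftTranslate (latticePt 0 0 0) f = f := by
  have h0 : latticePt (n := n) 0 0 0 = 0 := by
    rw [latticePt_zero_zero]
    simp
  rw [h0, leftTranslate_zero]

theorem latticePt_sub_central {n : ℕ} (k l : Fin n → ℤ) (j m : ℤ) :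
    latticePt k l j - (0, 0, (m : ℝ)) = latticePt k l (j - m) := by
  refine Prod.ext ?_ (Prod.ext ?_ ?_) <;> simp [latticePt]

theorem leftTranslate_central_latticePt {n : ℕ} (f : Heis n → ℂ) (k l : Fin n → ℤ) (j m : ℤ) :
    leftTranslate (latticePt 0 0 m) f (latticePt k l j) = f (latticePt k l (j - m)) := by
  rw [latticePt_zero_zero, leftTranslate_central_apply, latticePt_sub_central]

theorem isCompact_unitCube (n : ℕ) : IsCompact (unitCube n) := by
  have h1 : IsCompact {x : EuclideanSpace ℝ (Fin n) | ∀ i, x i ∈ Set.Icc (0 : ℝ) 1} := by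
    have h2 : IsCompact (Set.univ.pi fun _ : Fin n => Set.Icc (0 : ℝ) 1) :=
      isCompact_univ_pi fun _ => isCompact_Icc
    have h3 := h2.image (PiLp.continuous_toLp 2 fun _ : Fin n => ℝ)
    convert h3 using 1
    ext x
    constructor
    · exact fun hx => ⟨x.ofLp, fun i _ => hx i, rfl⟩
    · rintro ⟨y, hy, rfl⟩ i
      exact hy i trivial
  have h4 := h1.prod (h1.prod (isCompact_Icc (a := (0 : ℝ)) (b := 1)))
  convert h4 using 1
  ext X
  simp [unitCube, Set.mem_prod]

section Sampling

variable {n : ℕ} {φ : Heis n → ℂ}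

/-- For the unit sequence at `0` and `(k,l) = (0,0)` the series is `φ` itself. -/
theorem continuous_of_tendsto_continuous
    (hφconv : ∀ (k l : Fin n → ℤ) (c : ℤ → ℂ), Memℓp c 2 →
      ∃ s : Heis n → ℂ, Continuous s ∧ ∀ X : Heis n,
        Tendsto (fun N : ℕ => ∑ m ∈ Finset.Icc (-(N : ℤ)) N,
          c m * leftTranslate (latticePt k l m) φ X) atTop (𝓝 (s X))) : Continuous φ := by
  obtain ⟨s, hs, hlim⟩ := hφconv 0 0 _ (memℓp_single 0)
  convert hs
  funext X
  refine tendsto_nhds_unique ?_ (hlim X)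
  have := tendsto_sum_single (fun m => leftTranslate (latticePt 0 0 m) φ X) 0
  rwa [leftTranslate_latticePt_zero] at this

theorem iSup_unitCube_lt_top
    (hφconv : ∀ (k l : Fin n → ℤ) (c : ℤ → ℂ), Memℓp c 2 →
      ∃ s : Heis n → ℂ, Continuous s ∧ ∀ X : Heis n,
        Tendsto (fun N : ℕ => ∑ m ∈ Finset.Icc (-(N : ℤ)) N,
          c m * leftTranslate (latticePt k l m) φ X) atTop (𝓝 (s X))) (k l : Fin n → ℤ) :
    (⨆ X ∈ unitCube n, ∑' m : ℤ, ‖leftTranslate (latticePt k l m) φ X‖ₑ ^ 2) < ∞ := by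
  obtain ⟨C, hC⟩ := exists_tsum_enorm_sq_le (fun m => leftTranslate (latticePt k l m) φ)
    (unitCube n) fun c hc => by
      obtain ⟨s, hs, hlim⟩ := hφconv k l c hc
      exact ⟨s, (isCompact_unitCube n).exists_bound_of_continuousOn hs.continuousOn, hlim⟩
  exact (iSup₂_le hC).trans_lt ENNReal.ofReal_lt_top

/-- At the single point `(2k,l,0)` the central translates take the values `φ(2k,l,-m)`, so the bound
for `(0,0)` on a one-point set suffices. -/
theorem memℓp_samples
    (hφconv : ∀ (k l : Fin n → ℤ) (c : ℤ → ℂ), Memℓp c 2 →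
      ∃ s : Heis n → ℂ, Continuous s ∧ ∀ X : Heis n,
        Tendsto (fun N : ℕ => ∑ m ∈ Finset.Icc (-(N : ℤ)) N,
          c m * leftTranslate (latticePt k l m) φ X) atTop (𝓝 (s X))) (k l : Fin n → ℤ) :
    Memℓp (fun m : ℤ => φ (latticePt k l m)) 2 := by
  obtain ⟨C, hC⟩ := exists_tsum_enorm_sq_le (fun m => leftTranslate (latticePt 0 0 m) φ)
    {latticePt k l 0} fun c hc => by
      obtain ⟨s, hs, hlim⟩ := hφconv 0 0 c hc
      exact ⟨s, isCompact_singleton.exists_bound_of_continuousOn hs.continuousOn, hlim⟩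
  have h := hC _ rfl
  simp only [leftTranslate_central_latticePt, zero_sub] at h
  refine memℓp_of_tsum_enorm_sq (ne_top_of_le_ne_top ENNReal.ofReal_ne_top (le_trans ?_ h))
  exact ((Equiv.neg ℤ).tsum_eq fun m => ‖φ (latticePt k l m)‖ₑ ^ 2).ge

end Sampling

/-! ### Change of measure on the circle -/

theorem exists_restriction {α : Type*} [MeasurableSpace α] {μ ν : Measure α} {C : ℝ≥0∞}
    (hC : C ≠ ∞) (h : ν ≤ C • μ) :
    ∃ R : Lp ℂ 2 μ →L[ℂ] Lp ℂ 2 ν, ∀ f, R f =ᵐ[ν] f := by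
  have hac : ν ≪ μ := Measure.absolutelyContinuous_of_le_smul h
  have hmem : ∀ f : Lp ℂ 2 μ, MemLp f 2 ν := fun f => (Lp.memLp f).of_measure_le_smul hC h
  let T : Lp ℂ 2 μ →ₗ[ℂ] Lp ℂ 2 ν :=
    { toFun := fun f => (hmem f).toLp f
      map_add' := fun f g => by
        rw [← MemLp.toLp_add]
        exact MemLp.toLp_congr _ _ (hac.ae_eq (Lp.coeFn_add f g))
      map_smul' := fun c f => by
        rw [RingHom.id_apply, ← MemLp.toLp_const_smul]
        exact MemLp.toLp_congr _ _ (hac.ae_eq (Lp.coeFn_smul c f)) }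
  refine ⟨T.mkContinuous (C ^ (1 / (2 : ℝ≥0∞)).toReal).toReal fun f => ?_,
    fun f => (hmem f).coeFn_toLp⟩
  change ‖(hmem f).toLp f‖ ≤ _
  rw [Lp.norm_toLp, Lp.norm_def, ← ENNReal.toReal_mul]
  refine ENNReal.toReal_mono (ENNReal.mul_ne_top ?_ (Lp.eLpNorm_ne_top f))
    (eLpNorm_le_of_measure_le_smul h)
  exact ENNReal.rpow_ne_top_of_nonneg ENNReal.toReal_nonneg hC

/-- Boundedness of the density makes `L²` of Haar measure map continuously to `L²(W dx)`, which
carries convergent Fourier series into the model. -/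
theorem exists_restriction_densityMeasure {W : AddCircle (1 : ℝ) → ℝ≥0∞} {B : ℝ}
    [IsFiniteMeasure (densityMeasure W)]
    (hB : ∀ᵐ x ∂AddCircle.haarAddCircle, W x ≤ ENNReal.ofReal B) :
    ∃ R : Lp ℂ 2 (AddCircle.haarAddCircle (T := (1 : ℝ))) →L[ℂ] Lp ℂ 2 (densityMeasure W),
      (∀ f, R f =ᵐ[densityMeasure W] f) ∧ ∀ m, R (fourierLp 2 m) = charLp _ m := by
  have h : densityMeasure W ≤ ENNReal.ofReal B • AddCircle.haarAddCircle := by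
    rw [← withDensity_const]
    exact withDensity_mono hB
  obtain ⟨R, hR⟩ := exists_restriction ENNReal.ofReal_ne_top h
  refine ⟨R, hR, fun m => Lp.ext ?_⟩
  exact (hR _).trans (((Measure.absolutelyContinuous_of_le_smul h).ae_eq
    (coeFn_fourierLp 2 m)).trans (coeFn_charLp _ m).symm)

/-- Integration against a finite measure is a continuous functional on `C(ℝ/ℤ)`, hence determined on
trigonometric polynomials. -/
theorem measure_eq_of_integral_fourier {μ ν : Measure (AddCircle (1 : ℝ))} [IsFiniteMeasure μ]
    [IsFiniteMeasure ν] (h : ∀ m : ℤ, ∫ x, fourier m x ∂μ = ∫ x, fourier m x ∂ν) : μ = ν := by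
  let I : (ρ : Measure (AddCircle (1 : ℝ))) → [IsFiniteMeasure ρ] →
      C(AddCircle (1 : ℝ), ℂ) →L[ℂ] ℂ :=
    fun ρ _ => (innerSL ℂ (charLp ρ 0)).comp (ContinuousMap.toLp (E := ℂ) 2 ρ ℂ)
  have hI : ∀ (ρ : Measure (AddCircle (1 : ℝ))) [IsFiniteMeasure ρ] (f : C(AddCircle (1 : ℝ), ℂ)),
      I ρ f = ∫ x, f x ∂ρ := by
    intro ρ _ f
    simp only [I, ContinuousLinearMap.comp_apply, innerSL_apply_apply]
    rw [inner_charLp_left]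
    refine integral_congr_ae ?_
    filter_upwards [ContinuousMap.coeFn_toLp (p := 2) (𝕜 := ℂ) ρ f] with x hx
    rw [hx]
    simp
  have hIe : I μ = I ν := by
    refine ContinuousLinearMap.ext_on (s := Set.range (@fourier 1)) ?_ ?_
    · exact Submodule.dense_iff_topologicalClosure_eq_top.2 span_fourier_closure_eq_top
    · rintro _ ⟨m, rfl⟩
      rw [hI, hI, h m]
  refine ext_of_forall_integral_eq_of_IsFiniteMeasure fun f => ?_
  have h1 := DFunLike.congr_fun hIe
    (ContinuousMap.comp ⟨Complex.ofReal, Complex.continuous_ofReal⟩ f.toContinuousMap)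
  rw [hI, hI] at h1
  simp only [ContinuousMap.comp_apply, ContinuousMap.coe_mk, integral_complex_ofReal] at h1
  exact_mod_cast h1

/-- The element of `L²` of the circle with Fourier coefficients `a`. -/
def ofFourierCoeff (a : ℤ → ℂ) (ha : Memℓp a 2) :
    Lp ℂ 2 (AddCircle.haarAddCircle (T := (1 : ℝ))) := fourierBasis.repr.symm ⟨a, ha⟩

theorem fourierCoeff_ofFourierCoeff (a : ℤ → ℂ) (ha : Memℓp a 2) (m : ℤ) :
    fourierCoeff (ofFourierCoeff a ha) m = a m := by
  rw [← fourierBasis_repr, ofFourierCoeff, LinearIsometryEquiv.apply_symm_apply]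

theorem memLp_fourier_mul {μ : Measure (AddCircle (1 : ℝ))} {p : AddCircle (1 : ℝ) → ℂ}
    (hp : MemLp p 2 μ) (j : ℤ) : MemLp (fun x => fourier j x * p x) 2 μ := by
  refine hp.of_le ((fourier j).continuous.aestronglyMeasurable.mul hp.1) (ae_of_all _ fun x => ?_)
  rw [norm_mul, fourier_apply, Circle.norm_coe, one_mul]

/-- Multiplication by the character `fourier j` shifts Fourier coefficients by `j`. -/
theorem hasSum_fourier_shift (a : ℤ → ℂ) (ha : Memℓp a 2) (j : ℤ) :
    HasSum (fun m => a (m - j) • fourierLp (T := (1 : ℝ)) 2 m)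
      ((memLp_fourier_mul (Lp.memLp (ofFourierCoeff a ha)) j).toLp _) := by
  convert hasSum_fourier_series_L2
    ((memLp_fourier_mul (Lp.memLp (ofFourierCoeff a ha)) j).toLp _) using 2 with m
  congr 1
  rw [← fourierCoeff_ofFourierCoeff a ha, fourierCoeff, fourierCoeff]
  refine integral_congr_ae ?_
  filter_upwards [(memLp_fourier_mul (Lp.memLp (ofFourierCoeff a ha)) j).coeFn_toLp] with x hx
  rw [hx, smul_eq_mul, smul_eq_mul, ← mul_assoc, ← fourier_add]
  congr 3
  ring

/-! ### The sampling identity -/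

section SamplingIdentity

variable {n : ℕ} {φ ψ : Heis n → ℂ} {hφ : MemLp φ 2 volume} {hψ : MemLp ψ 2 volume}
  {W W' : AddCircle (1 : ℝ) → ℝ≥0∞} {B : ℝ}

theorem hasSum_isometry_shift [IsFiniteMeasure (densityMeasure W)] {H : Type*}
    [NormedAddCommGroup H] [InnerProductSpace ℂ H]
    {R : Lp ℂ 2 (AddCircle.haarAddCircle (T := (1 : ℝ))) →L[ℂ] Lp ℂ 2 (densityMeasure W)}
    (hR : ∀ m, R (fourierLp 2 m) = charLp _ m) (J : Lp ℂ 2 (densityMeasure W) →ₗᵢ[ℂ] H)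
    (a : ℤ → ℂ) (ha : Memℓp a 2) (j : ℤ) :
    HasSum (fun m => a (m - j) • J (charLp _ m))
      (J (R ((memLp_fourier_mul (Lp.memLp (ofFourierCoeff a ha)) j).toLp _))) := by
  have h := (hasSum_fourier_shift a ha j).mapL (J.toContinuousLinearMap.comp R)
  simpa only [ContinuousLinearMap.comp_apply, map_smul, hR,
    LinearIsometry.coe_toContinuousLinearMap] using h

theorem inner_restriction_shift
    {R : Lp ℂ 2 (AddCircle.haarAddCircle (T := (1 : ℝ))) →L[ℂ] Lp ℂ 2 (densityMeasure W)}
    (hR : ∀ f, R f =ᵐ[densityMeasure W] f)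
    (p : Lp ℂ 2 (AddCircle.haarAddCircle (T := (1 : ℝ)))) (j : ℤ) :
    inner ℂ (R ((memLp_fourier_mul (Lp.memLp p) 0).toLp _))
      (R ((memLp_fourier_mul (Lp.memLp p) j).toLp _)) =
      ∫ x, fourier j x * ((‖p x‖ₑ ^ 2).toReal : ℂ) ∂densityMeasure W := by
  have hac : densityMeasure W ≪ AddCircle.haarAddCircle := withDensity_absolutelyContinuous _ _
  rw [L2.inner_def]
  refine integral_congr_ae ?_
  filter_upwards [hR ((memLp_fourier_mul (Lp.memLp p) 0).toLp _),
    hR ((memLp_fourier_mul (Lp.memLp p) j).toLp _),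
    hac.ae_le (memLp_fourier_mul (Lp.memLp p) 0).coeFn_toLp,
    hac.ae_le (memLp_fourier_mul (Lp.memLp p) j).coeFn_toLp] with x h1 h2 h3 h4
  rw [h1, h2, h3, h4, RCLike.inner_apply', fourier_zero, one_mul, mul_left_comm, RCLike.conj_mul,
    ENNReal.toReal_pow, toReal_enorm]
  push_cast
  rfl

/-- If the central translates of `φ` are expanded along the lattice translates of `ψ` with
coefficients `a k l (m - j)`, then the spectral density of `φ` is that of `ψ` times
`∑ |p_{k,l}|²`, where `p_{k,l}` has Fourier coefficients `a k l`. -/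
theorem IsSpectralDensity.eq_mul_tsum (hW : IsSpectralDensity φ hφ W)
    (hW' : IsSpectralDensity ψ hψ W') (hC : ConditionC ψ)
    (hB : ∀ᵐ x ∂AddCircle.haarAddCircle, W' x ≤ ENNReal.ofReal B)
    (a : (Fin n → ℤ) → (Fin n → ℤ) → ℤ → ℂ) (ha : ∀ k l, Memℓp (a k l) 2)
    (hsum : ∀ j, HasSum (fun i : (Fin n → ℤ) × (Fin n → ℤ) × ℤ =>
      a i.1 i.2.1 (i.2.2 - j) • translateLp (latticePt i.1 i.2.1 i.2.2) ψ hψ)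
      (translateLp (latticePt 0 0 j) φ hφ)) :
    ∀ᵐ x ∂AddCircle.haarAddCircle,
      W x = W' x * ∑' i : (Fin n → ℤ) × (Fin n → ℤ),
        ‖ofFourierCoeff (a i.1 i.2) (ha i.1 i.2) x‖ₑ ^ 2 := by
  have := hW.isFiniteMeasure
  have := hW'.isFiniteMeasure
  obtain ⟨R, hR, hRm⟩ := exists_restriction_densityMeasure hB
  choose J hJ using fun i : (Fin n → ℤ) × (Fin n → ℤ) => hW'.exists_isometry i.1 i.2
  let p : (Fin n → ℤ) × (Fin n → ℤ) → Lp ℂ 2 (AddCircle.haarAddCircle (T := (1 : ℝ))) :=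
    fun i => ofFourierCoeff (a i.1 i.2) (ha i.1 i.2)
  let u : (Fin n → ℤ) × (Fin n → ℤ) → ℤ → Lp ℂ 2 (densityMeasure W') := fun i j =>
    R ((memLp_fourier_mul (Lp.memLp (p i)) j).toLp _)
  have horth : ∀ i i' q q', i ≠ i' → inner ℂ (J i q) (J i' q') = 0 := fun i i' q q' h =>
    inner_isometry_eq_zero (J i) (J i') (fun m m' => by
      rw [hJ, hJ]
      exact inner_translateLp_lattice_eq_zero hψ hC h m m') q q'
  -- Unconditional convergence allows summing over `m` first; for fixed `(k,l)` the inner sum is the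
  -- image of `fourier j * p i`.
  have hexp : ∀ j, HasSum (fun i => J i (u i j)) (translateLp (latticePt 0 0 j) φ hφ) := by
    intro j
    have h1 := (Equiv.prodAssoc (Fin n → ℤ) (Fin n → ℤ) ℤ).hasSum_iff.2 (hsum j)
    refine h1.prod_fiberwise fun i => ?_
    have h2 := hasSum_isometry_shift hRm (J i) (a i.1 i.2) (ha i.1 i.2) j
    simp only [hJ] at h2
    exact h2
  have hcoef : ∀ i v, inner ℂ (J i v) (translateLp (latticePt 0 0 0) φ hφ) =
      inner ℂ v (u i 0) := by
    intro i v
    have h1 := (hexp 0).mapL (innerSL ℂ (J i v))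
    simp only [innerSL_apply_apply] at h1
    have h2 := hasSum_single (f := fun i' => inner ℂ (J i v) (J i' (u i' 0))) i fun i' hi' =>
      horth i i' _ _ hi'.symm
    rw [h1.unique h2, (J i).inner_map_map]
  -- Pairing the expansions for `0` and `j`: orthogonality leaves the diagonal terms, and the
  -- left-hand inner product is a Fourier coefficient of `W dx`.
  have hparseval : ∀ j, HasSum (fun i => inner ℂ (u i 0) (u i j))
      (∫ x, fourier j x ∂densityMeasure W) := by
    intro j
    have h1 := (hexp j).mapL (innerSL ℂ (translateLp (latticePt 0 0 0) φ hφ))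
    simp only [innerSL_apply_apply] at h1
    have h2 : inner ℂ (translateLp (latticePt 0 0 0) φ hφ) (translateLp (latticePt 0 0 j) φ hφ) =
        ∫ x, fourier j x ∂densityMeasure W := by
      rw [← inner_conj_symm, translateLp_lattice_zero, ← hW.integral_conj_fourier, ← integral_conj]
      simp only [Complex.conj_conj]
    have h3 : ∀ i, inner ℂ (translateLp (latticePt 0 0 0) φ hφ) (J i (u i j)) =
        inner ℂ (u i 0) (u i j) := fun i => by
      rw [← inner_conj_symm, hcoef, inner_conj_symm]
    simp only [h2, h3] at h1
    exact h1
  have hpm : ∀ i, Measurable fun x => ‖p i x‖ₑ ^ 2 := fun i =>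
    (Lp.stronglyMeasurable (p i)).measurable.enorm.pow_const 2
  let S : AddCircle (1 : ℝ) → ℝ≥0∞ := fun x => ∑' i, ‖p i x‖ₑ ^ 2
  have hS : Measurable S := Measurable.tsum hpm
  have hu : ∀ i, ∫⁻ x, ‖p i x‖ₑ ^ 2 ∂densityMeasure W' = ‖u i 0‖ₑ ^ 2 := by
    intro i
    rw [← lintegral_enorm_sq_toLp]
    refine lintegral_congr_ae ?_
    have hac : densityMeasure W' ≪ AddCircle.haarAddCircle := withDensity_absolutelyContinuous _ _
    filter_upwards [hR ((memLp_fourier_mul (Lp.memLp (p i)) 0).toLp _),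
      hac.ae_le (memLp_fourier_mul (Lp.memLp (p i)) 0).coeFn_toLp] with x h1 h2
    rw [h1, h2, fourier_zero, one_mul]
  -- The case `j = 0` of the preceding expansion.
  have hSfin : ∫⁻ x, S x ∂densityMeasure W' ≠ ∞ := by
    rw [lintegral_tsum fun i => (hpm i).aemeasurable]
    have h1 := (hparseval 0).summable.norm
    have h2 : ∀ i, ‖u i 0‖ₑ ^ 2 = ENNReal.ofReal ‖inner ℂ (u i 0) (u i 0)‖ := by
      intro i
      rw [inner_self_eq_norm_sq_to_K, norm_pow, RCLike.norm_ofReal, abs_norm,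
        ENNReal.ofReal_pow (norm_nonneg _), ofReal_norm]
    simp only [hu, h2]
    exact h1.tsum_ofReal_ne_top
  have hSlt : ∀ᵐ x ∂densityMeasure W', S x < ∞ := ae_lt_top hS hSfin
  have : IsFiniteMeasure ((densityMeasure W').withDensity S) := isFiniteMeasure_withDensity hSfin
  -- Both are finite measures, and the expansion identifies all their Fourier coefficients.
  have heq : densityMeasure W = (densityMeasure W').withDensity S := by
    refine measure_eq_of_integral_fourier fun j => ?_
    rw [integral_withDensity_eq_integral_toReal_smul hS hSlt, ← (hparseval j).tsum_eq]
    simp only [u, inner_restriction_shift hR]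
    have hm : ∀ i, AEStronglyMeasurable
        (fun x => fourier j x * ((‖p i x‖ₑ ^ 2).toReal : ℂ)) (densityMeasure W') := fun i =>
      (fourier j).continuous.aestronglyMeasurable.mul
        (Complex.measurable_ofReal.comp (hpm i).ennreal_toReal).aestronglyMeasurable
    have hn : ∀ i x, ‖fourier j x * ((‖p i x‖ₑ ^ 2).toReal : ℂ)‖ₑ = ‖p i x‖ₑ ^ 2 := by
      intro i x
      rw [← ofReal_norm, norm_mul, fourier_apply, Circle.norm_coe, one_mul, Complex.norm_real,
        Real.norm_of_nonneg ENNReal.toReal_nonneg, ENNReal.ofReal_toReal (by simp)]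
    rw [← (integrable_tsum_of_lintegral hm (by simpa only [hn] using hSfin)).2]
    refine integral_congr_ae (ae_of_all _ fun x => ?_)
    simp only [S]
    rw [tsum_mul_left, ← Complex.ofReal_tsum, ENNReal.tsum_toReal_eq fun i => by simp,
      Complex.real_smul, mul_comm]
  rw [← withDensity_mul _ hW'.measurable hS] at heq
  exact (withDensity_eq_iff hW.measurable.aemeasurable
    (hW'.measurable.mul hS).aemeasurable hW.lintegral_ne_top).1 heq

/-- The Fourier series of the samples vanish where the spectral density does. -/
theorem IsSpectralDensity.ae_eq_zero (hW : IsSpectralDensity φ hφ W)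
    (hB : ∀ᵐ x ∂AddCircle.haarAddCircle, W x ≤ ENNReal.ofReal B)
    (hconv : ∀ c : ℤ → ℂ, Memℓp c 2 → ∃ s : Heis n → ℂ, Continuous s ∧ ∀ X : Heis n,
      Tendsto (fun N : ℕ => ∑ m ∈ Finset.Icc (-(N : ℤ)) N,
        c m * leftTranslate (latticePt 0 0 m) φ X) atTop (𝓝 (s X)))
    (k l : Fin n → ℤ) (ha : Memℓp (fun m => φ (latticePt k l m)) 2) :
    ∀ᵐ x ∂AddCircle.haarAddCircle, W x = 0 → ofFourierCoeff _ ha x = 0 := by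
  have := hW.isFiniteMeasure
  obtain ⟨R, hR, hRm⟩ := exists_restriction_densityMeasure hB
  obtain ⟨J, hJ⟩ := hW.exists_isometry 0 0
  have hZ : MeasurableSet {x | W x = 0} := hW.measurable (measurableSet_singleton 0)
  have hac : densityMeasure W ≪ AddCircle.haarAddCircle := withDensity_absolutelyContinuous _ _
  have he : MemLp ({x | W x = 0}.indicator fun _ => (1 : ℂ)) 2 AddCircle.haarAddCircle :=
    (memLp_const 1).indicator hZ
  -- The indicator of `{W = 0}` is invisible in `L²(W dx)`, so its Fourier coefficients give a
  -- series of translates with sum `0` in `L²`.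
  let e : Lp ℂ 2 (AddCircle.haarAddCircle (T := (1 : ℝ))) := he.toLp _
  have hc : Memℓp (fourierCoeff e) 2 := by
    rw [show fourierCoeff e = fourierBasis.repr e from
      funext fun m => (fourierBasis_repr e m).symm]
    exact lp.memℓp _
  have hRe : R e = 0 := by
    refine Lp.ext ?_
    have h0 : ∀ᵐ x ∂densityMeasure W, W x ≠ 0 := by
      rw [ae_withDensity_iff hW.measurable]
      exact ae_of_all _ fun x hx => hx
    filter_upwards [hR e, hac.ae_le he.coeFn_toLp, h0, Lp.coeFn_zero ℂ 2 (densityMeasure W)]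
      with x h1 h2 h3 h4
    rw [h1, h2, h4]
    simp [h3]
  have hsum : HasSum (fun m => fourierCoeff e m • translateLp (latticePt 0 0 m) φ hφ) 0 := by
    have h := (hasSum_fourier_series_L2 e).mapL (J.toContinuousLinearMap.comp R)
    simpa only [ContinuousLinearMap.comp_apply, map_smul, hRm, hRe, map_zero, hJ,
      LinearIsometry.coe_toContinuousLinearMap] using h
  obtain ⟨s, hs, hlim⟩ := hconv _ hc
  -- A subsequence of the partial sums tends to `0` a.e., so `s = 0` a.e.; continuity upgrades this
  -- to every point, in particular to the null set of lattice points.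
  have hs0 : s = 0 := by
    refine (hs.ae_eq_iff_eq volume continuous_zero).1 ?_
    obtain ⟨ns, hns, hae⟩ := (tendstoInMeasure_of_tendsto_Lp
      (hsum.comp Finset.tendsto_Icc_neg)).exists_seq_tendsto_ae
    have hpart : ∀ N : ℕ, ((∑ m ∈ Finset.Icc (-(N : ℤ)) N,
        fourierCoeff e m • translateLp (latticePt 0 0 m) φ hφ : Lp ℂ 2 (volume : Measure (Heis n))) :
        Heis n → ℂ) =ᵐ[volume] fun X => ∑ m ∈ Finset.Icc (-(N : ℤ)) N,
          fourierCoeff e m * leftTranslate (latticePt 0 0 m) φ X := by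
      intro N
      have h1 : ∀ᵐ X, ∀ m : ℤ, (fourierCoeff e m • translateLp (latticePt 0 0 m) φ hφ :
          Lp ℂ 2 (volume : Measure (Heis n))) X =
          fourierCoeff e m * leftTranslate (latticePt 0 0 m) φ X := by
        refine ae_all_iff.2 fun m => ?_
        filter_upwards [Lp.coeFn_smul (fourierCoeff e m) (translateLp (latticePt 0 0 m) φ hφ),
          (memLp_leftTranslate (latticePt 0 0 m) hφ).coeFn_toLp] with X h1 h2
        rw [h1, Pi.smul_apply, translateLp, h2, smul_eq_mul]
      filter_upwards [Lp.coeFn_fun_finsetSum (Finset.Icc (-(N : ℤ)) N)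
        fun m => fourierCoeff e m • translateLp (latticePt 0 0 m) φ hφ, h1] with X h2 h3
      rw [h2]
      exact Finset.sum_congr rfl fun m _ => h3 m
    filter_upwards [hae, ae_all_iff.2 hpart, Lp.coeFn_zero ℂ 2 (volume : Measure (Heis n))]
      with X h1 h2 h3
    rw [h3] at h1
    refine tendsto_nhds_unique ((hlim X).comp hns.tendsto_atTop) ?_
    refine h1.congr fun N => ?_
    exact h2 (ns N)
  let p := ofFourierCoeff _ ha
  have hpZ : MemLp ({x | W x = 0}.indicator p) 2 AddCircle.haarAddCircle :=
    (Lp.memLp p).indicator hZ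
  -- By Parseval the `j`-th Fourier coefficient of `p` restricted to `{W = 0}` is the convolution `∑
  -- φ(2k,l,j-m) c_m`, which is the value `s(2k,l,j) = 0`.
  have hzero : hpZ.toLp _ = 0 := by
    refine fourierBasis.repr.injective ?_
    rw [map_zero]
    ext j
    rw [fourierBasis_repr]
    have hy : MemLp (fun x => fourier j x * conj (p x)) 2 AddCircle.haarAddCircle :=
      memLp_fourier_mul (Lp.memLp p).star j
    have h1 := fourierBasis.hasSum_inner_mul_inner (hy.toLp _) e
    have h2 : ∀ m, inner ℂ (hy.toLp _) (fourierBasis m) = φ (latticePt k l (j - m)) := by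
      intro m
      rw [← fourierCoeff_ofFourierCoeff _ ha, coe_fourierBasis, L2.inner_def, fourierCoeff]
      refine integral_congr_ae ?_
      filter_upwards [hy.coeFn_toLp, coeFn_fourierLp 2 m] with x hx1 hx2
      rw [hx1, hx2, RCLike.inner_apply', map_mul, Complex.conj_conj, ← fourier_neg, mul_right_comm,
        ← fourier_add, smul_eq_mul]
      congr 3
      ring
    have h3 : ∀ m, inner ℂ (fourierBasis m) e = fourierCoeff e m := fun m => by
      rw [← HilbertBasis.repr_apply_apply, fourierBasis_repr]
    simp only [h2, h3] at h1
    have h4 := hlim (latticePt k l j)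
    simp only [leftTranslate_central_latticePt, hs0] at h4
    have h5 := tendsto_nhds_unique (h1.comp Finset.tendsto_Icc_neg)
      (h4.congr fun N => Finset.sum_congr rfl fun m _ => mul_comm _ _)
    rw [L2.inner_def] at h5
    refine Eq.trans ?_ h5
    rw [fourierCoeff]
    refine integral_congr_ae ?_
    filter_upwards [hpZ.coeFn_toLp, hy.coeFn_toLp, he.coeFn_toLp] with x hx1 hx2 hx3
    rw [hx1, hx2, hx3, RCLike.inner_apply', map_mul, Complex.conj_conj, ← fourier_neg, smul_eq_mul]
    by_cases hx : W x = 0 <;> simp [hx]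
  filter_upwards [hpZ.coeFn_toLp, Lp.coeFn_zero ℂ 2 (AddCircle.haarAddCircle (T := (1 : ℝ)))]
    with x h1 h2 hx
  rw [hzero, h2] at h1
  simpa [hx] using h1.symm

end SamplingIdentity

end HeisenbergSampling

end

/-! ### The main theorem -/

open HeisenbergSampling in
theorem mainTheorem1 (n : ℕ)
    (V₀ : Submodule ℂ (Lp ℂ 2 (volume : Measure (Heis n))))
    (hV₀ : IsClosed (V₀ : Set (Lp ℂ 2 (volume : Measure (Heis n)))))
    (φ : Heis n → ℂ) (hφ : MemLp φ 2 volume) (hφC : ConditionC φ)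
    (hφframe : IsFrameFor V₀ fun i : (Fin n → ℤ) × (Fin n → ℤ) × ℤ =>
      translateLp (latticePt i.1 i.2.1 i.2.2) φ hφ)
    (hφconv : ∀ (k l : Fin n → ℤ) (c : ℤ → ℂ), Memℓp c 2 →
      ∃ s : Heis n → ℂ, Continuous s ∧ ∀ X : Heis n,
        Tendsto (fun N : ℕ => ∑ m ∈ Finset.Icc (-(N : ℤ)) N,
          c m * leftTranslate (latticePt k l m) φ X) atTop (𝓝 (s X)))
    (ψ : Heis n → ℂ) (hψ : MemLp ψ 2 volume) (hψC : ConditionC ψ)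
    (hψframe : IsFrameFor V₀ fun i : (Fin n → ℤ) × (Fin n → ℤ) × ℤ =>
      translateLp (latticePt i.1 i.2.1 i.2.2) ψ hψ)
    (hsampling : ∀ f ∈ V₀, ∀ g : Heis n → ℂ, Continuous g → f =ᵐ[volume] g →
      HasSum (fun i : (Fin n → ℤ) × (Fin n → ℤ) × ℤ =>
        g (latticePt i.1 i.2.1 i.2.2) • translateLp (latticePt i.1 i.2.1 i.2.2) ψ hψ) f) :
    Continuous φ ∧
    (∀ k l : Fin n → ℤ,
      (⨆ X ∈ unitCube n, ∑' m : ℤ, ‖leftTranslate (latticePt k l m) φ X‖ₑ ^ 2) < ∞) ∧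
    (∀ k l : Fin n → ℤ, Memℓp (fun m : ℤ => φ (latticePt k l m)) 2) ∧
    ∃ A B : ℝ, 0 < A ∧ 0 < B ∧ ∀ᵐ lam : ℝ,
      (Omega φ).indicator (fun _ => ENNReal.ofReal A) lam
        ≤ (∑' i : (Fin n → ℤ) × (Fin n → ℤ), ‖P φ i.1 i.2 lam‖ₑ ^ 2) ∧
      (∑' i : (Fin n → ℤ) × (Fin n → ℤ), ‖P φ i.1 i.2 lam‖ₑ ^ 2)
        ≤ (Omega φ).indicator (fun _ => ENNReal.ofReal B) lam := by
  have hc := continuous_of_tendsto_continuous hφconv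
  have ha := memℓp_samples hφconv
  refine ⟨hc, iSup_unitCube_lt_top hφconv, ha, ?_⟩
  obtain ⟨W, hWm, hWfin, hWi, hWG⟩ := exists_spectralDensity hφ
  obtain ⟨W', hWm', hWfin', hWi', -⟩ := exists_spectralDensity hψ
  have hW : IsSpectralDensity φ hφ W := ⟨hWm, hWfin, hWi⟩
  have hW' : IsSpectralDensity ψ hψ W' := ⟨hWm', hWfin', hWi'⟩
  obtain ⟨A₁, B₁, hA₁, hB₁, hAB⟩ := hW.frame_bounds hV₀ hφC hφframe
  obtain ⟨A₂, B₂, hA₂, hB₂, hAB'⟩ := hW'.frame_bounds hV₀ hψC hψframe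
  -- The sampling formula for the translate of `φ` by `(0,0,j)`, whose value at `(2k,l,m)` is
  -- `φ(2k,l,m-j)`.
  have hsum : ∀ j, HasSum (fun i : (Fin n → ℤ) × (Fin n → ℤ) × ℤ =>
      φ (latticePt i.1 i.2.1 (i.2.2 - j)) • translateLp (latticePt i.1 i.2.1 i.2.2) ψ hψ)
      (translateLp (latticePt 0 0 j) φ hφ) := by
    intro j
    have hcj : Continuous (leftTranslate (latticePt 0 0 j) φ) := by
      simp only [latticePt_zero_zero, funext (leftTranslate_central_apply (j : ℝ) φ)]
      fun_prop
    have h := hsampling _ (hφframe.1 (0, 0, j)) _ hcj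
      (memLp_leftTranslate (latticePt 0 0 j) hφ).coeFn_toLp
    simpa only [leftTranslate_central_latticePt] using h
  have hS := hW.eq_mul_tsum hW' hψC (hAB'.mono fun x hx => hx.1)
    (fun k l m => φ (latticePt k l m)) ha hsum
  have hZ : ∀ᵐ x ∂AddCircle.haarAddCircle, ∀ i : (Fin n → ℤ) × (Fin n → ℤ),
      W x = 0 → ofFourierCoeff _ (ha i.1 i.2) x = 0 :=
    ae_all_iff.2 fun i => hW.ae_eq_zero (hAB.mono fun x hx => hx.1) (hφconv 0 0) i.1 i.2 _
  -- The sum equals `W / W'` where `W ≠ 0`, with `A₁ ≤ W ≤ B₁` and `A₂ ≤ W' ≤ B₂`.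
  refine ⟨A₁ / B₂, B₁ / A₂, by positivity, by positivity, ?_⟩
  filter_upwards [ae_of_ae_addCircle hS, ae_of_ae_addCircle hZ, ae_of_ae_addCircle hAB,
    ae_of_ae_addCircle hAB', hWG] with lam h1 h2 h3 h4 h5
  have hP : ∀ i : (Fin n → ℤ) × (Fin n → ℤ),
      P φ i.1 i.2 lam = ofFourierCoeff _ (ha i.1 i.2) lam := fun i => by
    rw [P, fourierSeriesL2, dif_pos (ha i.1 i.2)]
    rfl
  simp only [hP]
  have hΩ : lam ∈ Omega φ ↔ W lam ≠ 0 := by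
    rw [Omega, Set.mem_ofPred_eq, h5, ENNReal.toReal_pos_iff, pos_iff_ne_zero]
    exact and_iff_left (h3.1.trans_lt ENNReal.ofReal_lt_top)
  by_cases h0 : W lam = 0
  · have hn : lam ∉ Omega φ := fun h => hΩ.1 h h0
    simp [hn, fun i => h2 i h0]
  · rw [Set.indicator_of_mem (hΩ.2 h0), Set.indicator_of_mem (hΩ.2 h0)]
    -- The identity `W = W' ∑ |P|²` forces `W' ≠ 0` wherever `W ≠ 0`, which makes the lower bound
    -- `A₂` available.
    have h0' : W' lam ≠ 0 := fun h => h0 (by rw [h1, h, zero_mul])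
    have h6 := h3.2 h0
    have h7 := h4.2 h0'
    rw [ENNReal.ofReal_div_of_pos hB₂, ENNReal.ofReal_div_of_pos hA₂]
    constructor
    · refine ENNReal.div_le_of_le_mul' ?_
      refine h6.trans (h1.le.trans ?_)
      gcongr
      exact h4.1
    · rw [ENNReal.le_div_iff_mul_le (Or.inl (by simpa using hA₂)) (Or.inl ENNReal.ofReal_ne_top),
        mul_comm]
      refine le_trans ?_ (h1.ge.trans h3.1)
      gcongr
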